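/- Let $H\in(\tfrac12,1)$, $\nu\in(0,1)$, $T>0$ and $R_1<R_2$. On a probability space $(\Omega,\mathcal F,P)$ let $X=\{X(\phi):\phi\in\mathcal D(\mathbb R^2)\}$ be a centered Gaussian family indexed by the smooth compactly supported functions on $\mathbb R^2$, with covariance $$E\big(X(\phi)X(\psi)\big)=H(2H-1)\int_{[0,T]^2}du\,dv\,|u-v|^{2H-2}\int_{\mathbb R^2}dx\,dy\,|x-y|^{-\nu}\phi(u,x)\psi(v,y).$$ Let $\mathcal R(u,x)=\big(\tfrac{u-x}{\sqrt2},\tfrac{u+x}{\sqrt2}\big)$ be the rotation of the plane by $45^\circ$, let $$D_T=\{(s,t)\in\mathcal R([R_1,R_2]^2):\ -s\le t\le -s+\sqrt2\,T\},$$ and for $\varphi\in\mathcal D(D_T)$ (a test function supported in $D_T$) set $\tilde X(\varphi)=X(\varphi\circ\mathcal R)$. For $(s,t)\in D_T$ define $$x(s,t)=\tilde X\big(\mathbf 1_{([0,s]\times[0,t])\cap D_T}\big),$$ where $[0,a]$ means $[a,0]$ if $a<0$, and where $\tilde X(\mathbf 1_A)$, $A\subseteq D_T$, denotes the limit in $L^2(\Omega)$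 of $\tilde X(\varphi_n)$ for any uniformly bounded sequence $(\varphi_n)$ in $\mathcal D(D_T)$ that converges to $\mathbf 1_A$ almost everywhere. For $\eta,\hat\eta\in(0,1)$ let $\mathcal C^{\eta,\hat\eta}(D_T)$ be the space of continuous functions $f$ on $D_T$ such that $$\sup\frac{|f(s_2,t_2)-f(s_2,t_1)-f(s_1,t_2)+f(s_1,t_1)|}{|s_2-s_1|^{\eta}\,|t_2-t_1|^{\hat\eta}}<\infty,$$ the supremum being over all $s_1<s_2$ and $t_1<t_2$ with $[s_1,s_2]\times[t_1,t_2]\subseteq D_T$. Then $x(s,t)$ is well defined for every $(s,t)\in D_T$ (the approximating sequences exist, and the limit exists and does not depend on the sequence, up to almost sure equality), and the process $x$ has a modification $y=\{y(s,t):(s,t)\in D_T\}$ such that, almost surely, the path of $y$ belongs to $\mathcal C^{\eta,\hat\eta}(D_T)$ for all $\eta\in(0,\gamma)$ and $\hat\eta\in(0,\hat\gamma)$ and all $\gamma,\hat\gamma\in(\tfrac12,1)$ with $\gamma+\hat\gamma=H+\frac{2-\nu}{2}$. -/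

import Mathlib

open MeasureTheory ProbabilityTheory Filter Topology Set
open scoped ENNReal

noncomputable section

namespace FracNoise

/-- The space `𝓓(ℝ²)` of real-valued smooth compactly supported functions on the plane. -/
abbrev PlaneTest : Type := TestFunction (⊤ : TopologicalSpace.Opens (ℝ × ℝ)) ℝ ⊤

/-- The rotation of the plane by 45 degrees,
`(u, x) ↦ ((u - x) / √2, (u + x) / √2)`. Its inverse sends `(s, t)` to
`((s + t) / √2, (t - s) / √2)`. -/
def rot45 : (ℝ × ℝ) ≃L[ℝ] (ℝ × ℝ) where
  toFun p := ((p.1 - p.2) / √2, (p.1 + p.2) / √2)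
  invFun p := ((p.1 + p.2) / √2, (p.2 - p.1) / √2)
  map_add' p q := by ext <;> simp <;> ring
  map_smul' c p := by ext <;> simp <;> ring
  left_inv p := by
    have h : √2 * √2 = (2 : ℝ) := Real.mul_self_sqrt (by norm_num)
    ext <;> simp only [← add_div, ← sub_div, div_div, h] <;> ring
  right_inv p := by
    have h : √2 * √2 = (2 : ℝ) := Real.mul_self_sqrt (by norm_num)
    ext <;> simp only [← add_div, ← sub_div, div_div, h] <;> ring
  continuous_toFun := by fun_prop
  continuous_invFun := by fun_prop

/-- The test function `φ ∘ rot45`. -/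
def compRot (φ : PlaneTest) : PlaneTest where
  toFun := fun p => φ (rot45 p)
  contDiff' := φ.contDiff.comp rot45.contDiff
  hasCompactSupport' := φ.hasCompactSupport.comp_homeomorph rot45.toHomeomorph
  tsupport_subset' := fun _ _ => trivial

/-- The covariance functional of the noise: fractional in time (with Hurst index `H`, on the time
interval `[0, T]`), with the Riesz kernel `|x|^{-ν}` in space. -/
def noiseCov (H ν T : ℝ) (φ ψ : ℝ × ℝ → ℝ) : ℝ :=
  H * (2 * H - 1) *
    ∫ w in Icc (0 : ℝ) T ×ˢ Icc (0 : ℝ) T, |w.1 - w.2| ^ (2 * H - 2) *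
      ∫ z : ℝ × ℝ, |z.1 - z.2| ^ (-ν) * (φ (w.1, z.1) * ψ (w.2, z.2))

/-- `X` is a centered Gaussian family indexed by `𝓓(ℝ²)` with covariance `noiseCov H ν T`. -/
structure IsFractionalNoise {Ω : Type*} [MeasurableSpace Ω] (P : Measure Ω) (H ν T : ℝ)
    (X : PlaneTest → Ω → ℝ) : Prop where
  gaussian : IsGaussianProcess X P
  centered : ∀ φ, ∫ ω, X φ ω ∂P = 0
  covariance : ∀ φ ψ, ∫ ω, X φ ω * X ψ ω ∂P = noiseCov H ν T φ ψ

/-- The rotated noise `X̃(φ) = X(φ ∘ rot45)`. -/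
def rotatedNoise {Ω : Type*} (X : PlaneTest → Ω → ℝ) (φ : PlaneTest) : Ω → ℝ :=
  X (compRot φ)

/-- The domain `D_T`: the points `(s, t)` of the rotated square `rot45([R₁, R₂]²)` with
`-s ≤ t ≤ -s + √2 T`. -/
def domain (R₁ R₂ T : ℝ) : Set (ℝ × ℝ) :=
  {p | p ∈ rot45 '' (Icc R₁ R₂ ×ˢ Icc R₁ R₂) ∧ -p.1 ≤ p.2 ∧ p.2 ≤ -p.1 + √2 * T}

/-- `(φ n)` is a uniformly bounded sequence of test functions supported in `D` that converges
almost everywhere to the indicator function of `A`. -/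
structure IsApproximating (D A : Set (ℝ × ℝ)) (φ : ℕ → PlaneTest) : Prop where
  support : ∀ n, tsupport (φ n) ⊆ D
  bounded : ∃ M : ℝ, ∀ n p, |φ n p| ≤ M
  tendsto : ∀ᵐ p ∂(volume : Measure (ℝ × ℝ)),
    Tendsto (fun n => φ n p) atTop (𝓝 (A.indicator (fun _ => (1 : ℝ)) p))

/-- The random variable `ξ` is (a version of) `X̃(1_A)`, for `A ⊆ D`: it is the limit in `L²(Ω)` of
`X̃(φ n)`, for one and for every sequence `(φ n)` in `𝓓(D)` approximating `1_A`. -/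
structure IsRotatedNoiseOfSet {Ω : Type*} [MeasurableSpace Ω] (P : Measure Ω)
    (X : PlaneTest → Ω → ℝ) (D A : Set (ℝ × ℝ)) (ξ : Ω → ℝ) : Prop where
  memLp : MemLp ξ 2 P
  exists_approx : ∃ φ, IsApproximating D A φ
  tendsto : ∀ φ, IsApproximating D A φ →
    Tendsto (fun n => eLpNorm (rotatedNoise X (φ n) - ξ) 2 P) atTop (𝓝 0)

/-- The set `([0, s] × [0, t]) ∩ D`, where `[0, a]` is read as `[a, 0]` if `a` is negative. -/
def cornerRect (D : Set (ℝ × ℝ)) (p : ℝ × ℝ) : Set (ℝ × ℝ) :=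
  (uIcc 0 p.1 ×ˢ uIcc 0 p.2) ∩ D

/-- The increment of `f` on the rectangle `[s₁, s₂] × [t₁, t₂]`. -/
def rectIncr (f : ℝ × ℝ → ℝ) (s₁ s₂ t₁ t₂ : ℝ) : ℝ :=
  f (s₂, t₂) - f (s₂, t₁) - f (s₁, t₂) + f (s₁, t₁)

/-- The Hölder seminorm on rectangles contained in `D`. -/
def rectHolderNorm (D : Set (ℝ × ℝ)) (η η' : ℝ) (f : ℝ × ℝ → ℝ) : ℝ≥0∞ :=
  ⨆ (s₁ : ℝ) (s₂ : ℝ) (t₁ : ℝ) (t₂ : ℝ) (_ : s₁ < s₂) (_ : t₁ < t₂)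
    (_ : Icc s₁ s₂ ×ˢ Icc t₁ t₂ ⊆ D),
    ENNReal.ofReal (|rectIncr f s₁ s₂ t₁ t₂| / (|s₂ - s₁| ^ η * |t₂ - t₁| ^ η'))

/-- The space `C^{η,η'}(D)` of continuous functions on `D` with finite Hölder seminorm on
rectangles. -/
def MemRectHolder (D : Set (ℝ × ℝ)) (η η' : ℝ) (f : ℝ × ℝ → ℝ) : Prop :=
  ContinuousOn f D ∧ rectHolderNorm D η η' f < ⊤

end FracNoise

end

/-!
Rotating the plane turns the covariance of the noise into `∫ φ ⊗ ψ ∂m`, where the measure `m` on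
`D × D` has density `(s, t), (s', t') ↦ |s + t - s' - t'|^{2H-2} |t - s - t' + s'|^{-ν}`, up to a
constant. Splitting each factor between `s - s'` and `t - t'` shows that `m (R × R)` is at most
`C |I|^{2γ} |J|^{2γ'}` for every rectangle `R = I × J`. In particular `m` is finite, so the noise
extends in `L²` to bounded functions by dominated convergence.

The increment of the corner process over a rectangle is the Wiener integral of a function bounded
by the indicator of that rectangle, whatever the position of the rectangle relative to the axes.
Being Gaussian, its moments of order `2k` are at most a constant times
`(|I|^{2γ} |J|^{2γ'})^k`, and summing over dyadic cells gives a rectangular Hölder bound on the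
dyadic points, of any exponents `η < γ` and `η' < γ'`. The modification is the limit of the process
along dyadic approximations of `(s, t)`.
-/

noncomputable section

namespace FracNoise

/-! ### One-dimensional singular integrals -/

lemma lintegral_Ioc_enorm_rpow_neg {q r : ℝ} (hq : q < 1) (hr : 0 ≤ r) :
    ∫⁻ x in Ioc 0 r, ‖x‖ₑ ^ (-q) = ENNReal.ofReal (r ^ (1 - q) / (1 - q)) := by
  have h_ofReal : ∫⁻ x in Ioc 0 r, ‖x‖ₑ ^ (-q) = ∫⁻ x in Ioc 0 r, ENNReal.ofReal (x ^ (-q)) :=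
    setLIntegral_congr_fun measurableSet_Ioc fun x hx => by
      rw [Real.enorm_eq_ofReal hx.1.le, ENNReal.ofReal_rpow_of_pos hx.1]
  have h_int : IntervalIntegrable (fun x : ℝ => x ^ (-q)) volume 0 r :=
    intervalIntegral.intervalIntegrable_rpow' (by linarith)
  rw [h_ofReal, ← ofReal_integral_eq_lintegral_ofReal
      ((intervalIntegrable_iff_integrableOn_Ioc_of_le hr).1 h_int)
      (ae_restrict_of_forall_mem measurableSet_Ioc fun x hx => Real.rpow_nonneg hx.1.le _),
    ← intervalIntegral.integral_of_le hr, integral_rpow (Or.inl (by linarith)),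
    Real.zero_rpow (by linarith), sub_zero, neg_add_eq_sub]

lemma lintegral_Icc_enorm_rpow_neg_le {q r : ℝ} (hq : q < 1) (hr : 0 ≤ r) :
    ∫⁻ x in Icc (-r) r, ‖x‖ₑ ^ (-q) ≤ ENNReal.ofReal (2 * (r ^ (1 - q) / (1 - q))) := by
  have h_pos : ∫⁻ x in Icc 0 r, ‖x‖ₑ ^ (-q) = ENNReal.ofReal (r ^ (1 - q) / (1 - q)) := by
    rw [← lintegral_Ioc_enorm_rpow_neg hq hr]
    exact setLIntegral_congr Ioc_ae_eq_Icc.symm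
  have h_neg : ∫⁻ x in Icc (-r) 0, ‖x‖ₑ ^ (-q) = ∫⁻ x in Icc 0 r, ‖x‖ₑ ^ (-q) := by
    rw [← (Measure.measurePreserving_neg (volume : Measure ℝ)).setLIntegral_comp_preimage
      (s := Icc 0 r) measurableSet_Icc (f := fun x : ℝ => ‖x‖ₑ ^ (-q)) (by fun_prop)]
    simp
  have h_nonneg : 0 ≤ r ^ (1 - q) / (1 - q) := div_nonneg (Real.rpow_nonneg hr _) (by linarith)
  calc ∫⁻ x in Icc (-r) r, ‖x‖ₑ ^ (-q)
      = ∫⁻ x in Icc (-r) 0 ∪ Icc 0 r, ‖x‖ₑ ^ (-q) := by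
        rw [Icc_union_Icc_eq_Icc (neg_nonpos.2 hr) hr]
    _ ≤ (∫⁻ x in Icc (-r) 0, ‖x‖ₑ ^ (-q)) + ∫⁻ x in Icc 0 r, ‖x‖ₑ ^ (-q) :=
        lintegral_union_le _ _ _
    _ = ENNReal.ofReal (2 * (r ^ (1 - q) / (1 - q))) := by
        rw [h_neg, h_pos, ← ENNReal.ofReal_add h_nonneg h_nonneg, two_mul]

lemma enorm_rpow_neg_le_indicator_add {q r : ℝ} (hq : 0 ≤ q) (hr : 0 < r) (x : ℝ) :
    ‖x‖ₑ ^ (-q) ≤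
      (Icc (-r) r).indicator (fun x => ‖x‖ₑ ^ (-q)) x + ENNReal.ofReal (r ^ (-q)) := by
  by_cases hx : x ∈ Icc (-r) r
  · rw [indicator_of_mem hx]
    exact le_self_add
  · have hrx : r < |x| := by rwa [mem_Icc, ← abs_le, not_le] at hx
    rw [indicator_of_notMem hx, zero_add, Real.enorm_eq_ofReal_abs,
      ENNReal.ofReal_rpow_of_pos (hr.trans hrx)]
    exact ENNReal.ofReal_le_ofReal (Real.rpow_le_rpow_of_nonpos hr hrx.le (neg_nonpos.2 hq))

/-- The constant `C` in the bound `C * (d - c) ^ (1 - q)` of the integral of `|x - z| ^ (-q)` over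
`[c, d]`, uniformly in `z`. -/
def singConst (q : ℝ) : ℝ := 2 / (1 - q) + 1

lemma singConst_nonneg {q : ℝ} (hq : q < 1) : 0 ≤ singConst q :=
  add_nonneg (div_nonneg zero_le_two (sub_nonneg.2 hq.le)) zero_le_one

lemma lintegral_Icc_enorm_sub_rpow_neg_le {q c d : ℝ} (hq0 : 0 ≤ q) (hq : q < 1) (hcd : c ≤ d)
    (z : ℝ) :
    ∫⁻ x in Icc c d, ‖x - z‖ₑ ^ (-q) ≤ ENNReal.ofReal (singConst q * (d - c) ^ (1 - q)) := by
  rcases hcd.eq_or_lt with rfl | hlt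
  · simp
  set r := d - c
  have hr : 0 < r := sub_pos.2 hlt
  have : 0 < 1 - q := sub_pos.2 hq
  set near : ℝ → ℝ≥0∞ := (Icc (-r) r).indicator fun x => ‖x‖ₑ ^ (-q)
  have h_near : ∫⁻ x in Icc c d, near (x - z) ≤ ENNReal.ofReal (2 * (r ^ (1 - q) / (1 - q))) :=
    calc ∫⁻ x in Icc c d, near (x - z) ≤ ∫⁻ x, near (x - z) := setLIntegral_le_lintegral _ _
      _ = ∫⁻ x in Icc (-r) r, ‖x‖ₑ ^ (-q) := by
          rw [lintegral_sub_right_eq_self, lintegral_indicator measurableSet_Icc]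
      _ ≤ _ := lintegral_Icc_enorm_rpow_neg_le hq hr.le
  have h_far : ∫⁻ _ in Icc c d, ENNReal.ofReal (r ^ (-q)) = ENNReal.ofReal (r ^ (1 - q)) := by
    rw [setLIntegral_const, Real.volume_Icc, ← ENNReal.ofReal_mul (by positivity),
      ← Real.rpow_add_one hr.ne', neg_add_eq_sub]
  calc ∫⁻ x in Icc c d, ‖x - z‖ₑ ^ (-q)
      ≤ ∫⁻ x in Icc c d, (near (x - z) + ENNReal.ofReal (r ^ (-q))) :=
        lintegral_mono fun x => enorm_rpow_neg_le_indicator_add hq0 hr (x - z)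
    _ = (∫⁻ x in Icc c d, near (x - z)) + ENNReal.ofReal (r ^ (1 - q)) := by
        rw [lintegral_add_right _ measurable_const, h_far]
    _ ≤ ENNReal.ofReal (2 * (r ^ (1 - q) / (1 - q))) + ENNReal.ofReal (r ^ (1 - q)) := by
        gcongr
    _ = ENNReal.ofReal (singConst q * r ^ (1 - q)) := by
        rw [← ENNReal.ofReal_add (by positivity) (by positivity), singConst]
        ring_nf

/-! ### The rotated kernel -/

/-- In the rotated coordinates `(a, b) = (s - s', t - t')`, the kernel
`|u - v| ^ (-α) |x - y| ^ (-ν)` up to a constant factor. -/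
def rotKernel (α ν a b : ℝ) : ℝ := |a + b| ^ (-α) * |a - b| ^ (-ν)

lemma rotKernel_swap (α ν a b : ℝ) : rotKernel α ν b a = rotKernel α ν a b := by
  rw [rotKernel, rotKernel, add_comm b a, abs_sub_comm b a]

@[fun_prop]
lemma measurable_rotKernel (α ν : ℝ) {β : Type*} [MeasurableSpace β] {f g : β → ℝ}
    (hf : Measurable f) (hg : Measurable g) : Measurable fun x => rotKernel α ν (f x) (g x) := by
  simp only [rotKernel, ← Real.norm_eq_abs]
  fun_prop

lemma rpow_neg_mul_rpow_neg_le {A Z s α ν p q : ℝ} (hp : 0 ≤ p) (hνq : ν ≤ q)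
    (hpq : p + q = α + ν) (hs : 0 < s) (hZ : 0 < Z) (hsA : s ≤ A) (hZA : Z ≤ A) :
    A ^ (-α) * Z ^ (-ν) ≤ s ^ (-p) * Z ^ (-q) := by
  have hA : 0 < A := hs.trans_le hsA
  have h_s : A ^ (-p) ≤ s ^ (-p) := Real.rpow_le_rpow_of_nonpos hs hsA (neg_nonpos.2 hp)
  have h_Z : A ^ (-(q - ν)) ≤ Z ^ (-(q - ν)) :=
    Real.rpow_le_rpow_of_nonpos hZ hZA (neg_nonpos.2 (sub_nonneg.2 hνq))
  calc A ^ (-α) * Z ^ (-ν) = A ^ (-p) * A ^ (-(q - ν)) * Z ^ (-ν) := by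
        rw [← Real.rpow_add hA]; congr 2; linarith
    _ ≤ s ^ (-p) * Z ^ (-(q - ν)) * Z ^ (-ν) := by gcongr
    _ = s ^ (-p) * Z ^ (-q) := by rw [mul_assoc, ← Real.rpow_add hZ]; congr 2; ring

section PowerExchange

variable {α ν p q : ℝ}

lemma rotKernel_le (hp : 0 ≤ p) (hαq : α ≤ q) (hνq : ν ≤ q) (hpq : p + q = α + ν) {a b : ℝ}
    (ha : a ≠ 0) (hadd : a + b ≠ 0) (hsub : a - b ≠ 0) :
    rotKernel α ν a b ≤ |a| ^ (-p) * (|a - b| ^ (-q) + |a + b| ^ (-q)) := by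
  have h_max : |a| ≤ max |a + b| |a - b| := by
    have h_two : 2 * |a| ≤ |a + b| + |a - b| := by
      have h := abs_add_le (a + b) (a - b)
      rwa [add_add_sub_cancel, ← two_mul, abs_mul, abs_two] at h
    linarith [le_max_left |a + b| |a - b|, le_max_right |a + b| |a - b|]
  replace ha := abs_pos.2 ha
  replace hadd := abs_pos.2 hadd
  replace hsub := abs_pos.2 hsub
  rw [mul_add, rotKernel]
  rcases le_total |a - b| |a + b| with h | h
  · rw [max_eq_left h] at h_max
    exact (rpow_neg_mul_rpow_neg_le hp hνq hpq ha hsub h_max h).trans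
      (le_add_of_nonneg_right (by positivity))
  · rw [max_eq_right h] at h_max
    rw [mul_comm (|a + b| ^ (-α))]
    exact (rpow_neg_mul_rpow_neg_le hp hαq (by linarith) ha hadd h_max h).trans
      (le_add_of_nonneg_left (by positivity))

lemma ofReal_rotKernel_le (hα : 0 < α) (hν : 0 < ν) (hp : 0 < p) (hαq : α ≤ q)
    (hνq : ν ≤ q) (hpq : p + q = α + ν) (a b : ℝ) :
    ENNReal.ofReal (rotKernel α ν a b) ≤
      ‖a‖ₑ ^ (-p) * (‖a - b‖ₑ ^ (-q) + ‖a + b‖ₑ ^ (-q)) := by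
  by_cases hadd : a + b = 0
  · simp [rotKernel, hadd, Real.zero_rpow (neg_ne_zero.2 hα.ne')]
  by_cases hsub : a - b = 0
  · simp [rotKernel, hsub, Real.zero_rpow (neg_ne_zero.2 hν.ne')]
  by_cases ha : a = 0
  · have h_top : ‖a‖ₑ ^ (-p) = ⊤ := by simp [ha, ENNReal.zero_rpow_of_neg, hp]
    have h_ne : ‖a - b‖ₑ ^ (-q) + ‖a + b‖ₑ ^ (-q) ≠ 0 := by
      simp [ENNReal.rpow_eq_zero_iff, hadd]
    rw [h_top, ENNReal.top_mul h_ne]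
    exact le_top
  have ha' := abs_pos.2 ha
  have hadd' := abs_pos.2 hadd
  have hsub' := abs_pos.2 hsub
  simp only [Real.enorm_eq_ofReal_abs]
  rw [ENNReal.ofReal_rpow_of_pos ha', ENNReal.ofReal_rpow_of_pos hadd',
    ENNReal.ofReal_rpow_of_pos hsub', ← ENNReal.ofReal_add (by positivity) (by positivity),
    ← ENNReal.ofReal_mul (by positivity)]
  exact ENNReal.ofReal_le_ofReal (rotKernel_le hp.le hαq hνq hpq ha hadd hsub)

lemma lintegral_ofReal_rotKernel_le (hα : 0 < α) (hν : 0 < ν) (hp : 0 < p) (hq1 : q < 1)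
    (hαq : α ≤ q) (hνq : ν ≤ q) (hpq : p + q = α + ν) {e f : ℝ} (hef : e ≤ f) (a t : ℝ) :
    ∫⁻ t' in Icc e f, ENNReal.ofReal (rotKernel α ν a (t - t')) ≤
      ‖a‖ₑ ^ (-p) * ENNReal.ofReal (2 * (singConst q * (f - e) ^ (1 - q))) := by
  have h_nonneg : 0 ≤ singConst q * (f - e) ^ (1 - q) :=
    mul_nonneg (singConst_nonneg hq1) (Real.rpow_nonneg (sub_nonneg.2 hef) _)
  calc ∫⁻ t' in Icc e f, ENNReal.ofReal (rotKernel α ν a (t - t'))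
      ≤ ∫⁻ t' in Icc e f, ‖a‖ₑ ^ (-p) * (‖t' - (t - a)‖ₑ ^ (-q) + ‖t' - (t + a)‖ₑ ^ (-q)) := by
        refine lintegral_mono fun t' => ?_
        refine (ofReal_rotKernel_le hα hν hp hαq hνq hpq _ _).trans_eq ?_
        rw [← enorm_neg (a + (t - t'))]
        congr 4 <;> ring
    _ = ‖a‖ₑ ^ (-p) * ((∫⁻ t' in Icc e f, ‖t' - (t - a)‖ₑ ^ (-q)) +
          ∫⁻ t' in Icc e f, ‖t' - (t + a)‖ₑ ^ (-q)) := by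
        rw [lintegral_const_mul _ (by fun_prop), lintegral_add_left (by fun_prop)]
    _ ≤ ‖a‖ₑ ^ (-p) * ENNReal.ofReal (2 * (singConst q * (f - e) ^ (1 - q))) := by
        rw [two_mul, ENNReal.ofReal_add h_nonneg h_nonneg]
        gcongr <;> exact lintegral_Icc_enorm_sub_rpow_neg_le (hα.le.trans hαq) hq1 hef _

lemma lintegral_lintegral_rotKernel_le (hα : 0 < α) (hν : 0 < ν) (hp : 0 < p) (hp1 : p < 1)
    (hq1 : q < 1) (hαq : α ≤ q) (hνq : ν ≤ q) (hpq : p + q = α + ν)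
    {c d e f : ℝ} (hcd : c ≤ d) (hef : e ≤ f) (s t : ℝ) :
    ∫⁻ s' in Icc c d, ∫⁻ t' in Icc e f, ENNReal.ofReal (rotKernel α ν (s - s') (t - t')) ≤
      ENNReal.ofReal (2 * singConst p * singConst q * ((d - c) ^ (1 - p) * (f - e) ^ (1 - q))) := by
  have h_nonneg : 0 ≤ singConst p * (d - c) ^ (1 - p) :=
    mul_nonneg (singConst_nonneg hp1) (Real.rpow_nonneg (sub_nonneg.2 hcd) _)
  calc _ ≤ ∫⁻ s' in Icc c d, ‖s' - s‖ₑ ^ (-p) *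
        ENNReal.ofReal (2 * (singConst q * (f - e) ^ (1 - q))) := by
        refine lintegral_mono fun s' => ?_
        rw [← enorm_neg, neg_sub]
        exact lintegral_ofReal_rotKernel_le hα hν hp hq1 hαq hνq hpq hef _ t
    _ ≤ ENNReal.ofReal (singConst p * (d - c) ^ (1 - p)) *
        ENNReal.ofReal (2 * (singConst q * (f - e) ^ (1 - q))) := by
        rw [lintegral_mul_const _ (by fun_prop)]
        gcongr
        exact lintegral_Icc_enorm_sub_rpow_neg_le hp.le hp1 hcd _
    _ = _ := by
        rw [← ENNReal.ofReal_mul h_nonneg]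
        ring_nf

end PowerExchange

lemma rpow_mul_rpow_le_of_le {l m a b a' b' : ℝ} (hl : 0 ≤ l) (hlm : l ≤ m) (ha : 0 ≤ a)
    (haa : a ≤ a') (hb : 0 ≤ b') (hab : a + b = a' + b') :
    l ^ a' * m ^ b' ≤ l ^ a * m ^ b := by
  have hd := sub_nonneg.2 haa
  have hm := hl.trans hlm
  calc l ^ a' * m ^ b' = l ^ a * l ^ (a' - a) * m ^ b' := by
        rw [← Real.rpow_add_of_nonneg hl ha hd, add_sub_cancel]
    _ ≤ l ^ a * m ^ (a' - a) * m ^ b' := by gcongr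
    _ = l ^ a * m ^ b := by
        rw [mul_assoc, ← Real.rpow_add_of_nonneg hm hd hb]
        congr 2; linarith

section RectangleScaling

variable {α ν p q : ℝ} (hα : α ∈ Ioo (0 : ℝ) 1) (hν : ν ∈ Ioo (0 : ℝ) 1) (hp : p ∈ Ioo (0 : ℝ) 1)
  (hq : q ∈ Ioo (0 : ℝ) 1) (hpq : p + q = α + ν)
include hα hν hp hq hpq

-- On a rectangle that is longer in the second direction, raising `q` to `max q (max α ν)` only
-- improves the bound.
lemma exists_lintegral_rotKernel_le_of_short : ∃ C : ℝ, 0 ≤ C ∧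
    ∀ c d e f : ℝ, c ≤ d → e ≤ f → d - c ≤ f - e → ∀ s t,
      ∫⁻ s' in Icc c d, ∫⁻ t' in Icc e f, ENNReal.ofReal (rotKernel α ν (s - s') (t - t')) ≤
        ENNReal.ofReal (C * ((d - c) ^ (1 - p) * (f - e) ^ (1 - q))) := by
  obtain ⟨q', hqq, hαq, hνq, hq1, hq_lt⟩ :
      ∃ q', q ≤ q' ∧ α ≤ q' ∧ ν ≤ q' ∧ q' < 1 ∧ q' < α + ν :=
    ⟨max q (max α ν), le_max_left _ _, le_max_of_le_right (le_max_left _ _),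
      le_max_of_le_right (le_max_right _ _), max_lt hq.2 (max_lt hα.2 hν.2),
      max_lt (by linarith [hp.1]) (max_lt (by linarith [hν.1]) (by linarith [hα.1]))⟩
  obtain ⟨p', hp'⟩ : ∃ p', p' + q' = α + ν := ⟨_, sub_add_cancel _ q'⟩
  have hp0 : 0 < p' := by linarith
  have hpp : p' ≤ p := by linarith
  have hp1 : p' < 1 := hpp.trans_lt hp.2
  have hC : 0 ≤ 2 * singConst p' * singConst q' :=
    mul_nonneg (mul_nonneg zero_le_two (singConst_nonneg hp1)) (singConst_nonneg hq1)
  refine ⟨_, hC, fun c d e f hcd hef hle s t => ?_⟩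
  refine (lintegral_lintegral_rotKernel_le hα.1 hν.1 hp0 hp1 hq1 hαq hνq hp' hcd hef s t).trans
    (ENNReal.ofReal_le_ofReal (mul_le_mul_of_nonneg_left ?_ hC))
  exact rpow_mul_rpow_le_of_le (sub_nonneg.2 hcd) hle (sub_nonneg.2 hp.2.le) (by linarith)
    (sub_nonneg.2 hq1.le) (by linarith)

lemma exists_lintegral_rotKernel_le : ∃ C : ℝ, 0 ≤ C ∧
    ∀ c d e f : ℝ, c ≤ d → e ≤ f → ∀ s t,
      ∫⁻ s' in Icc c d, ∫⁻ t' in Icc e f, ENNReal.ofReal (rotKernel α ν (s - s') (t - t')) ≤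
        ENNReal.ofReal (C * ((d - c) ^ (1 - p) * (f - e) ^ (1 - q))) := by
  obtain ⟨C₁, hC₁, h₁⟩ := exists_lintegral_rotKernel_le_of_short hα hν hp hq hpq
  obtain ⟨C₂, -, h₂⟩ :=
    exists_lintegral_rotKernel_le_of_short hα hν hq hp ((add_comm q p).trans hpq)
  refine ⟨max C₁ C₂, hC₁.trans (le_max_left _ _), fun c d e f hcd hef s t => ?_⟩
  have : 0 ≤ d - c := sub_nonneg.2 hcd
  have : 0 ≤ f - e := sub_nonneg.2 hef
  rcases le_total (d - c) (f - e) with h | h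
  · refine (h₁ c d e f hcd hef h s t).trans (ENNReal.ofReal_le_ofReal ?_)
    gcongr
    exact le_max_left _ _
  · rw [lintegral_lintegral_swap (by fun_prop)]
    simp only [rotKernel_swap α ν (t - _) (s - _)]
    refine (h₂ e f c d hef hcd h t s).trans (ENNReal.ofReal_le_ofReal ?_)
    rw [mul_comm ((f - e) ^ _)]
    gcongr
    exact le_max_right _ _

end RectangleScaling

/-! ### The covariance measure -/

lemma rot45_apply (p : ℝ × ℝ) : rot45 p = ((p.1 - p.2) / √2, (p.1 + p.2) / √2) := rfl

lemma rot45_symm_apply (p : ℝ × ℝ) :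
    rot45.symm p = ((p.1 + p.2) / √2, (p.2 - p.1) / √2) := rfl

lemma det_rot45 : LinearMap.det (rot45 : (ℝ × ℝ) →ₗ[ℝ] ℝ × ℝ) = 1 := by
  have h_fst : (rot45 : (ℝ × ℝ) →ₗ[ℝ] ℝ × ℝ) (1, 0) = (1 / √2, 1 / √2) :=
    (rot45_apply (1, 0)).trans (by simp)
  have h_snd : (rot45 : (ℝ × ℝ) →ₗ[ℝ] ℝ × ℝ) (0, 1) = (-1 / √2, 1 / √2) :=
    (rot45_apply (0, 1)).trans (by simp)
  rw [← LinearMap.det_toMatrix (Module.Basis.finTwoProd ℝ), Matrix.det_fin_two]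
  simp only [LinearMap.toMatrix_apply, Module.Basis.finTwoProd_zero, Module.Basis.finTwoProd_one,
    Module.Basis.coe_finTwoProd_repr, h_fst, h_snd, Matrix.cons_val_zero, Matrix.cons_val_one]
  field_simp
  norm_num

lemma measurePreserving_rot45 : MeasurePreserving rot45 volume volume := by
  refine ⟨rot45.continuous.measurable, ?_⟩
  have h := Measure.map_linearMap_addHaar_eq_smul_addHaar (volume : Measure (ℝ × ℝ))
    (f := (rot45 : (ℝ × ℝ) →ₗ[ℝ] ℝ × ℝ)) (by simp [det_rot45])
  simpa [det_rot45] using h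

lemma measurePreserving_prodProdProdComm {α β γ δ : Type*} [MeasurableSpace α]
    [MeasurableSpace β] [MeasurableSpace γ] [MeasurableSpace δ] (μ : Measure α) (ν : Measure β)
    (ρ : Measure γ) (σ : Measure δ) [SFinite μ] [SFinite ν] [SFinite ρ] [SFinite σ] :
    MeasurePreserving (fun z : (α × β) × (γ × δ) => ((z.1.1, z.2.1), (z.1.2, z.2.2)))
      ((μ.prod ν).prod (ρ.prod σ)) ((μ.prod ρ).prod (ν.prod σ)) := by
  have h_middle : MeasurePreserving (fun z : β × (γ × δ) => (z.2.1, (z.1, z.2.2)))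
      (ν.prod (ρ.prod σ)) (ρ.prod (ν.prod σ)) :=
    ((measurePreserving_prodAssoc ρ ν σ).comp
      (Measure.measurePreserving_swap.prod (MeasurePreserving.id σ))).comp
        (measurePreserving_prodAssoc ν ρ σ).symm
  exact ((measurePreserving_prodAssoc μ ρ (ν.prod σ)).symm.comp
    ((MeasurePreserving.id μ).prod h_middle)).comp (measurePreserving_prodAssoc μ ν (ρ.prod σ))

/-- The change of variables from `((u, v), (x, y))` (times first, positions second) to the pair of
rotated points `(rot45 (u, x), rot45 (v, y))`. -/
def rotPair (z : (ℝ × ℝ) × (ℝ × ℝ)) : (ℝ × ℝ) × (ℝ × ℝ) :=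
  (rot45 (z.1.1, z.2.1), rot45 (z.1.2, z.2.2))

lemma measurePreserving_rotPair : MeasurePreserving rotPair volume volume :=
  (measurePreserving_rot45.prod measurePreserving_rot45).comp
    (measurePreserving_prodProdProdComm volume volume volume volume)

lemma measurableEmbedding_rotPair : MeasurableEmbedding rotPair := by
  refine measurePreserving_rotPair.measurable.measurableEmbedding ?_
  rintro ⟨⟨a, b⟩, c, d⟩ ⟨⟨a', b'⟩, c', d'⟩ h
  simp only [rotPair, Prod.mk.injEq, EmbeddingLike.apply_eq_iff_eq] at h ⊢
  tauto

lemma rot45_mem_domain_iff {R₁ R₂ T : ℝ} (p : ℝ × ℝ) :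
    rot45 p ∈ domain R₁ R₂ T ↔ p ∈ (Icc R₁ R₂ ∩ Icc 0 T) ×ˢ Icc R₁ R₂ := by
  have h_sqrt : 0 < √(2 : ℝ) := by positivity
  have h_sum : (rot45 p).1 + (rot45 p).2 = √2 * p.1 := by
    rw [rot45_apply]
    field_simp
    linear_combination (-p.1) * Real.mul_self_sqrt zero_le_two
  have h_lower : -(rot45 p).1 ≤ (rot45 p).2 ↔ 0 ≤ p.1 := by
    rw [neg_le_iff_add_nonneg', h_sum, mul_nonneg_iff_of_pos_left h_sqrt]
  have h_upper : (rot45 p).2 ≤ -(rot45 p).1 + √2 * T ↔ p.1 ≤ T := by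
    rw [le_neg_add_iff_add_le, h_sum, mul_le_mul_iff_right₀ h_sqrt]
  simp only [domain, mem_ofPred_eq, rot45.injective.mem_set_image, mem_prod, mem_inter_iff,
    h_lower, h_upper, mem_Icc]
  tauto

lemma domain_eq (R₁ R₂ T : ℝ) :
    domain R₁ R₂ T = rot45 '' ((Icc R₁ R₂ ∩ Icc 0 T) ×ˢ Icc R₁ R₂) := by
  ext x
  obtain ⟨p, rfl⟩ := rot45.surjective x
  rw [rot45_mem_domain_iff, rot45.injective.mem_set_image]

lemma isCompact_domain (R₁ R₂ T : ℝ) : IsCompact (domain R₁ R₂ T) := by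
  rw [domain_eq]
  exact ((isCompact_Icc.inter isCompact_Icc).prod isCompact_Icc).image rot45.continuous

lemma convex_domain (R₁ R₂ T : ℝ) : Convex ℝ (domain R₁ R₂ T) := by
  rw [domain_eq]
  exact (((convex_Icc _ _).inter (convex_Icc _ _)).prod (convex_Icc _ _)).linear_image
    (rot45 : (ℝ × ℝ) →ₗ[ℝ] ℝ × ℝ)

/-- The kernel of `noiseCov` at a pair of rotated points. -/
def noiseDensity (H ν : ℝ) (z : (ℝ × ℝ) × (ℝ × ℝ)) : ℝ :=
  H * (2 * H - 1) * (|(rot45.symm z.1).1 - (rot45.symm z.2).1| ^ (2 * H - 2) *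
    |(rot45.symm z.1).2 - (rot45.symm z.2).2| ^ (-ν))

/-- The constant factor relating `noiseDensity` to `rotKernel`. -/
def noiseConst (H ν : ℝ) : ℝ := H * (2 * H - 1) * (√2 ^ (2 * H - 2) * √2 ^ (-ν))⁻¹

lemma noiseConst_nonneg {H : ℝ} (hH : 1 / 2 ≤ H) (ν : ℝ) : 0 ≤ noiseConst H ν := by
  have : 0 ≤ H := by linarith
  have : 0 ≤ 2 * H - 1 := by linarith
  unfold noiseConst
  positivity

lemma noiseDensity_eq (H ν : ℝ) (z : (ℝ × ℝ) × (ℝ × ℝ)) :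
    noiseDensity H ν z =
      noiseConst H ν * rotKernel (2 - 2 * H) ν (z.1.1 - z.2.1) (z.1.2 - z.2.2) := by
  have h_sqrt : (0 : ℝ) ≤ √2 := Real.sqrt_nonneg 2
  have h_time : (rot45.symm z.1).1 - (rot45.symm z.2).1 =
      (z.1.1 - z.2.1 + (z.1.2 - z.2.2)) / √2 := by simp only [rot45_symm_apply]; ring
  have h_space : (rot45.symm z.1).2 - (rot45.symm z.2).2 =
      -((z.1.1 - z.2.1 - (z.1.2 - z.2.2)) / √2) := by simp only [rot45_symm_apply]; ring
  rw [noiseDensity, h_time, h_space, abs_neg, abs_div, abs_div, abs_of_nonneg h_sqrt,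
    Real.div_rpow (abs_nonneg _) h_sqrt, Real.div_rpow (abs_nonneg _) h_sqrt, rotKernel, neg_sub,
    noiseConst, mul_inv]
  ring

lemma noiseDensity_nonneg {H : ℝ} (hH : 1 / 2 ≤ H) (ν : ℝ) (z : (ℝ × ℝ) × (ℝ × ℝ)) :
    0 ≤ noiseDensity H ν z := by
  rw [noiseDensity_eq]
  exact mul_nonneg (noiseConst_nonneg hH ν)
    (mul_nonneg (Real.rpow_nonneg (abs_nonneg _) _) (Real.rpow_nonneg (abs_nonneg _) _))

@[fun_prop]
lemma measurable_noiseDensity (H ν : ℝ) : Measurable (noiseDensity H ν) := by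
  simp only [funext (noiseDensity_eq H ν)]
  fun_prop

/-- The measure on pairs of points of `D` such that, for test functions supported in `D`, the
covariance of `X̃(φ)` and `X̃(ψ)` is the integral of `φ ⊗ ψ`. -/
def noiseMeasure (H ν : ℝ) (D : Set (ℝ × ℝ)) : Measure ((ℝ × ℝ) × (ℝ × ℝ)) :=
  (volume.restrict (D ×ˢ D)).withDensity fun z => ENNReal.ofReal (noiseDensity H ν z)

lemma noiseMeasure_absolutelyContinuous (H ν : ℝ) (D : Set (ℝ × ℝ)) :
    noiseMeasure H ν D ≪ (volume : Measure ((ℝ × ℝ) × (ℝ × ℝ))) :=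
  (withDensity_absolutelyContinuous _ _).trans Measure.restrict_le_self.absolutelyContinuous

/-- `m (R × R) ≤ C * (a ^ γ * b ^ γ') ^ 2` for every rectangle `R` with side lengths `a` and `b`. If
`m` is a covariance measure, this bounds the standard deviations of rectangle increments. -/
def HasRectBound (m : Measure ((ℝ × ℝ) × (ℝ × ℝ))) (γ γ' : ℝ) : Prop :=
  ∃ C : ℝ, 0 ≤ C ∧ ∀ c d e f : ℝ, c ≤ d → e ≤ f →
    m ((Icc c d ×ˢ Icc e f) ×ˢ (Icc c d ×ˢ Icc e f)) ≤
      ENNReal.ofReal (C * ((d - c) ^ (2 * γ) * (f - e) ^ (2 * γ')))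

lemma withDensity_restrict_prod_self_le {E : Type*} [MeasurableSpace E] {μ : Measure E}
    [SFinite μ] {f : E × E → ℝ≥0∞} (hf : Measurable f) (S : Set (E × E)) {A : Set E}
    (hA : MeasurableSet A) {B : ℝ≥0∞} (hB : ∀ x, ∫⁻ y in A, f (x, y) ∂μ ≤ B) :
    (((μ.prod μ).restrict S).withDensity f) (A ×ˢ A) ≤ B * μ A :=
  calc (((μ.prod μ).restrict S).withDensity f) (A ×ˢ A)
      = ∫⁻ z in A ×ˢ A, f z ∂((μ.prod μ).restrict S) := withDensity_apply _ (hA.prod hA)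
    _ ≤ ∫⁻ z in A ×ˢ A, f z ∂(μ.prod μ) :=
        lintegral_mono' (Measure.restrict_mono_measure Measure.restrict_le_self _) le_rfl
    _ = ∫⁻ x in A, ∫⁻ y in A, f (x, y) ∂μ ∂μ := setLIntegral_prod _ hf.aemeasurable
    _ ≤ ∫⁻ _ in A, B ∂μ := lintegral_mono hB
    _ = B * μ A := setLIntegral_const _ _

section NoiseMeasure

variable {H ν γ γ' : ℝ} (hH : H ∈ Ioo (1 / 2 : ℝ) 1) (hν : ν ∈ Ioo (0 : ℝ) 1)

include hH in
lemma setLIntegral_noiseDensity (x : ℝ × ℝ) (c d e f : ℝ) :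
    ∫⁻ y in Icc c d ×ˢ Icc e f, ENNReal.ofReal (noiseDensity H ν (x, y)) =
      ENNReal.ofReal (noiseConst H ν) * ∫⁻ s' in Icc c d, ∫⁻ t' in Icc e f,
        ENNReal.ofReal (rotKernel (2 - 2 * H) ν (x.1 - s') (x.2 - t')) := by
  simp only [noiseDensity_eq, ENNReal.ofReal_mul (noiseConst_nonneg hH.1.le ν)]
  rw [lintegral_const_mul _ (by fun_prop), Measure.volume_eq_prod,
    setLIntegral_prod _ (by fun_prop)]

include hH hν in
lemma hasRectBound_noiseMeasure (hγ : γ ∈ Ioo (1 / 2 : ℝ) 1) (hγ' : γ' ∈ Ioo (1 / 2 : ℝ) 1)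
    (hsum : γ + γ' = H + (2 - ν) / 2) (D : Set (ℝ × ℝ)) :
    HasRectBound (noiseMeasure H ν D) γ γ' := by
  obtain ⟨C, hC, h_kernel⟩ := exists_lintegral_rotKernel_le (α := 2 - 2 * H) (ν := ν)
    (p := 2 - 2 * γ) (q := 2 - 2 * γ') ⟨by linarith [hH.2], by linarith [hH.1]⟩ hν
    ⟨by linarith [hγ.2], by linarith [hγ.1]⟩ ⟨by linarith [hγ'.2], by linarith [hγ'.1]⟩
    (by linarith)
  have hκ := noiseConst_nonneg hH.1.le ν
  refine ⟨noiseConst H ν * C, mul_nonneg hκ hC, fun c d e f hcd hef => ?_⟩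
  have hdc := sub_nonneg.2 hcd
  have hfe := sub_nonneg.2 hef
  set B := C * ((d - c) ^ (1 - (2 - 2 * γ)) * (f - e) ^ (1 - (2 - 2 * γ')))
  have hB : 0 ≤ B := by positivity
  have h_rpow {r δ : ℝ} (hr : 0 ≤ r) (hδ : 1 / 2 < δ) :
      r ^ (1 - (2 - 2 * δ)) * r = r ^ (2 * δ) := by
    rw [← Real.rpow_add_one' hr (by linarith)]
    ring_nf
  calc noiseMeasure H ν D ((Icc c d ×ˢ Icc e f) ×ˢ (Icc c d ×ˢ Icc e f))
      ≤ ENNReal.ofReal (noiseConst H ν) * ENNReal.ofReal B * volume (Icc c d ×ˢ Icc e f) :=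
        withDensity_restrict_prod_self_le (by fun_prop) _ (measurableSet_Icc.prod measurableSet_Icc)
          fun x => by
            rw [setLIntegral_noiseDensity hH]
            gcongr
            exact h_kernel c d e f hcd hef x.1 x.2
    _ = ENNReal.ofReal (noiseConst H ν * B * ((d - c) * (f - e))) := by
        rw [Measure.volume_eq_prod, Measure.prod_prod, Real.volume_Icc, Real.volume_Icc,
          ← ENNReal.ofReal_mul hκ, ← ENNReal.ofReal_mul hdc,
          ← ENNReal.ofReal_mul (mul_nonneg hκ hB)]
    _ = _ := by
        rw [← h_rpow hdc hγ.1, ← h_rpow hfe hγ'.1]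
        simp only [B]
        ring_nf

lemma HasRectBound.isFiniteMeasure {m : Measure ((ℝ × ℝ) × (ℝ × ℝ))}
    (hm : HasRectBound m γ γ') {D : Set (ℝ × ℝ)} (hD : Bornology.IsBounded D)
    (hmD : m (D ×ˢ D)ᶜ = 0) : IsFiniteMeasure m := by
  obtain ⟨C, -, hC⟩ := hm
  obtain ⟨M, hM0, hM⟩ := hD.subset_closedBall_lt 0 0
  have h_sub : D ⊆ Icc (-M) M ×ˢ Icc (-M) M := by
    rwa [Prod.zero_eq_mk, ← closedBall_prod_same, Real.closedBall_eq_Icc, zero_sub, zero_add] at hM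
  refine ⟨?_⟩
  calc m univ ≤ m (D ×ˢ D) + m (D ×ˢ D)ᶜ := by
        rw [← union_compl_self (D ×ˢ D)]
        exact measure_union_le _ _
    _ ≤ m ((Icc (-M) M ×ˢ Icc (-M) M) ×ˢ (Icc (-M) M ×ˢ Icc (-M) M)) := by
        rw [hmD, add_zero]
        exact measure_mono (prod_mono h_sub h_sub)
    _ < ⊤ := (hC _ _ _ _ (by linarith) (by linarith)).trans_lt ENNReal.ofReal_lt_top

include hH hν in
lemma isFiniteMeasure_noiseMeasure {D : Set (ℝ × ℝ)} (hDm : MeasurableSet D)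
    (hD : Bornology.IsBounded D) : IsFiniteMeasure (noiseMeasure H ν D) := by
  have hγ : (H + (2 - ν) / 2) / 2 ∈ Ioo (1 / 2 : ℝ) 1 :=
    ⟨by linarith [hH.1, hν.2], by linarith [hH.2, hν.1]⟩
  refine HasRectBound.isFiniteMeasure
    (hasRectBound_noiseMeasure hH hν hγ hγ (add_halves _) D) hD ?_
  exact withDensity_absolutelyContinuous _ _
    ((Measure.restrict_apply_eq_zero' (hDm.prod hDm)).2 (by simp))

end NoiseMeasure

lemma integrable_mul_prod (m : Measure ((ℝ × ℝ) × (ℝ × ℝ))) [IsFiniteMeasure m]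
    (φ ψ : PlaneTest) : Integrable (fun z => φ z.1 * ψ z.2) m := by
  obtain ⟨A, hA⟩ := φ.hasCompactSupport.exists_bound_of_continuous φ.continuous
  obtain ⟨B, hB⟩ := ψ.hasCompactSupport.exists_bound_of_continuous ψ.continuous
  refine Integrable.of_bound (C := A * B) ((φ.continuous.comp continuous_fst).mul
    (ψ.continuous.comp continuous_snd)).aestronglyMeasurable (Eventually.of_forall fun z => ?_)
  rw [norm_mul]
  exact mul_le_mul (hA _) (hB _) (norm_nonneg _) ((norm_nonneg _).trans (hA 0))

lemma mul_prod_eq_zero {D : Set (ℝ × ℝ)} {φ ψ : PlaneTest} (hφ : tsupport φ ⊆ D)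
    (hψ : tsupport ψ ⊆ D) {z : (ℝ × ℝ) × (ℝ × ℝ)} (hz : z ∉ D ×ˢ D) : φ z.1 * ψ z.2 = 0 := by
  rw [mem_prod, not_and_or] at hz
  rcases hz with h | h
  · rw [image_eq_zero_of_notMem_tsupport fun hmem => h (hφ hmem), zero_mul]
  · rw [image_eq_zero_of_notMem_tsupport fun hmem => h (hψ hmem), mul_zero]

section NoiseCov

variable {H ν T R₁ R₂ : ℝ} {D : Set (ℝ × ℝ)} {F : (ℝ × ℝ) × (ℝ × ℝ) → ℝ}

lemma integral_noiseMeasure (hH : 1 / 2 ≤ H) (hF : ∀ z ∉ D ×ˢ D, F z = 0) :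
    ∫ z, F z ∂(noiseMeasure H ν D) = ∫ z, noiseDensity H ν z * F z := by
  rw [noiseMeasure, integral_withDensity_eq_integral_toReal_smul (by fun_prop) (by simp)]
  simp only [ENNReal.toReal_ofReal (noiseDensity_nonneg hH ν _), smul_eq_mul]
  exact setIntegral_eq_integral_of_forall_compl_eq_zero fun z hz => by rw [hF z hz, mul_zero]

lemma integrable_noiseDensity_mul (hH : 1 / 2 ≤ H) (hF : ∀ z ∉ D ×ˢ D, F z = 0)
    (h_int : Integrable F (noiseMeasure H ν D)) :
    Integrable fun z => noiseDensity H ν z * F z := by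
  rw [noiseMeasure, integrable_withDensity_iff_integrable_smul' (by fun_prop) (by simp)] at h_int
  simp only [ENNReal.toReal_ofReal (noiseDensity_nonneg hH ν _), smul_eq_mul] at h_int
  exact (integrableOn_iff_integrable_of_support_subset
    (Function.support_subset_iff'.2 fun z hz => by rw [hF z hz, mul_zero])).1 h_int

lemma noiseDensity_rotPair (H ν : ℝ) (w z : ℝ × ℝ) :
    noiseDensity H ν (rotPair (w, z)) =
      H * (2 * H - 1) * (|w.1 - w.2| ^ (2 * H - 2) * |z.1 - z.2| ^ (-ν)) := by
  simp only [noiseDensity, rotPair, ContinuousLinearEquiv.symm_apply_apply]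

lemma mem_of_rotPair_mem_domain {w z : ℝ × ℝ}
    (h : rotPair (w, z) ∈ domain R₁ R₂ T ×ˢ domain R₁ R₂ T) : w ∈ Icc 0 T ×ˢ Icc 0 T := by
  simp only [rotPair, mem_prod, rot45_mem_domain_iff] at h
  exact ⟨h.1.1.2, h.2.1.2⟩

lemma noiseCov_compRot (hH : H ∈ Ioo (1 / 2 : ℝ) 1) (hν : ν ∈ Ioo (0 : ℝ) 1)
    {φ ψ : PlaneTest} (hφ : tsupport φ ⊆ domain R₁ R₂ T) (hψ : tsupport ψ ⊆ domain R₁ R₂ T) :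
    noiseCov H ν T (compRot φ) (compRot ψ) =
      ∫ z, φ z.1 * ψ z.2 ∂(noiseMeasure H ν (domain R₁ R₂ T)) := by
  have hD := isCompact_domain R₁ R₂ T
  have := isFiniteMeasure_noiseMeasure hH hν hD.measurableSet hD.isBounded
  have h_zero := fun z => mul_prod_eq_zero (z := z) hφ hψ
  set F : (ℝ × ℝ) × (ℝ × ℝ) → ℝ := fun z => noiseDensity H ν z * (φ z.1 * ψ z.2)
  have h_int : Integrable fun z => F (rotPair z) :=
    (measurePreserving_rotPair.integrable_comp_emb measurableEmbedding_rotPair).2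
      (integrable_noiseDensity_mul hH.1.le h_zero (integrable_mul_prod _ φ ψ))
  have h_time : ∀ w ∉ Icc (0 : ℝ) T ×ˢ Icc (0 : ℝ) T, ∫ z, F (rotPair (w, z)) = 0 :=
    fun w hw => integral_eq_zero_of_ae <| Eventually.of_forall fun z => by
      simp only [F, h_zero _ fun h => hw (mem_of_rotPair_mem_domain h), mul_zero, Pi.zero_apply]
  have h_kernel : ∀ w z, F (rotPair (w, z)) = H * (2 * H - 1) * (|w.1 - w.2| ^ (2 * H - 2) *
      (|z.1 - z.2| ^ (-ν) * (compRot φ (w.1, z.1) * compRot ψ (w.2, z.2)))) := fun w z => by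
    simp only [F, noiseDensity_rotPair, mul_assoc]
    rfl
  calc noiseCov H ν T (compRot φ) (compRot ψ)
      = ∫ w in Icc (0 : ℝ) T ×ˢ Icc (0 : ℝ) T, ∫ z, F (rotPair (w, z)) := by
        simp only [h_kernel, integral_const_mul, noiseCov]
    _ = ∫ w, ∫ z, F (rotPair (w, z)) := setIntegral_eq_integral_of_forall_compl_eq_zero h_time
    _ = ∫ z, F (rotPair z) := (integral_prod _ h_int).symm
    _ = ∫ z, F z := measurePreserving_rotPair.integral_comp measurableEmbedding_rotPair F
    _ = ∫ z, φ z.1 * ψ z.2 ∂(noiseMeasure H ν (domain R₁ R₂ T)) :=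
        (integral_noiseMeasure hH.1.le h_zero).symm

end NoiseCov

/-! ### Moments of centered Gaussian variables -/

/-- The moment of order `2 * k` of the standard Gaussian law. -/
def gaussMoment (k : ℕ) : ℝ≥0∞ := ∫⁻ x, ‖x‖ₑ ^ (2 * k) ∂(gaussianReal 0 1)

lemma gaussMoment_lt_top (k : ℕ) : gaussMoment k < ⊤ := by
  have h := (memLp_id_gaussianReal (μ := 0) (v := 1) (2 * k : ℕ)).integrable_norm_pow'
  simpa [gaussMoment, HasFiniteIntegral, enorm_pow] using h.2

lemma lintegral_enorm_pow_of_hasGaussianLaw {Ω : Type*} [MeasurableSpace Ω] {P : Measure Ω}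
    {Y : Ω → ℝ} (hY : HasGaussianLaw Y P) (h0 : ∫ ω, Y ω ∂P = 0) (k : ℕ) :
    ∫⁻ ω, ‖Y ω‖ₑ ^ (2 * k) ∂P = gaussMoment k * ENNReal.ofReal (∫ ω, Y ω * Y ω ∂P) ^ k := by
  set v := ∫ ω, Y ω * Y ω ∂P
  have hv : 0 ≤ v := integral_nonneg fun _ => mul_self_nonneg _
  have h_var : Var[Y; P] = v := by
    simp only [variance_of_integral_eq_zero hY.aemeasurable h0, sq, v]
  have h_law : P.map Y = (gaussianReal 0 1).map (fun x => √v * x) := by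
    rw [hY.map_eq_gaussianReal, h0, h_var, gaussianReal_map_const_mul, mul_zero, mul_one]
    congr 1
    ext
    simp [Real.sq_sqrt hv, hv]
  calc ∫⁻ ω, ‖Y ω‖ₑ ^ (2 * k) ∂P = ∫⁻ x, ‖x‖ₑ ^ (2 * k) ∂(P.map Y) := by
        rw [lintegral_map' (by fun_prop) hY.aemeasurable]
    _ = ∫⁻ x, ‖√v * x‖ₑ ^ (2 * k) ∂(gaussianReal 0 1) := by
        rw [h_law, lintegral_map (by fun_prop) (by fun_prop)]
    _ = ∫⁻ x, ENNReal.ofReal v ^ k * ‖x‖ₑ ^ (2 * k) ∂(gaussianReal 0 1) := by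
        refine lintegral_congr fun x => ?_
        rw [enorm_mul, mul_pow, pow_mul, Real.enorm_eq_ofReal (Real.sqrt_nonneg _),
          ← ENNReal.ofReal_pow (Real.sqrt_nonneg _), Real.sq_sqrt hv]
    _ = gaussMoment k * ENNReal.ofReal v ^ k := by
        rw [lintegral_const_mul _ (by fun_prop), mul_comm, gaussMoment]

/-! ### Wiener integrals with respect to a Gaussian noise -/

section DominatedConvergence

variable {E : Type*} [MeasurableSpace E] {μ : Measure E} {m : Measure (E × E)}
  {ι : Type*} {l : Filter ι} {f : ι → E → ℝ} {g : E → ℝ}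

lemma ae_tendsto_mul_prod (hm : m ≪ μ.prod μ)
    (h : ∀ᵐ p ∂μ, Tendsto (fun i => f i p) l (𝓝 (g p))) :
    ∀ᵐ z ∂m, Tendsto (fun i => f i z.1 * f i z.2) l (𝓝 (g z.1 * g z.2)) := by
  filter_upwards [hm.ae_le (Measure.quasiMeasurePreserving_fst.ae h),
    hm.ae_le (Measure.quasiMeasurePreserving_snd.ae h)] with z h_fst h_snd
  exact h_fst.mul h_snd

lemma tendsto_integral_mul_prod [IsFiniteMeasure m] [l.IsCountablyGenerated] {M : ℝ}
    (hm : m ≪ μ.prod μ) (hf : ∀ i, Measurable (f i)) (hM : ∀ i p, |f i p| ≤ M)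
    (h : ∀ᵐ p ∂μ, Tendsto (fun i => f i p) l (𝓝 (g p))) :
    Tendsto (fun i => ∫ z, f i z.1 * f i z.2 ∂m) l (𝓝 (∫ z, g z.1 * g z.2 ∂m)) := by
  refine tendsto_integral_filter_of_dominated_convergence (fun _ => M * M)
    (Eventually.of_forall fun i =>
      (((hf i).comp measurable_fst).mul ((hf i).comp measurable_snd)).aestronglyMeasurable)
    (Eventually.of_forall fun i => Eventually.of_forall fun z => ?_)
    (integrable_const _) (ae_tendsto_mul_prod hm h)
  rw [norm_mul]
  exact mul_le_mul (hM i _) (hM i _) (norm_nonneg _) ((abs_nonneg _).trans (hM i z.1))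

end DominatedConvergence

/-- `(φ n)` is a uniformly bounded sequence of test functions supported in `D` that converges
almost everywhere to `g`; this is `IsApproximating` for functions other than indicators. -/
structure IsTestApprox (D : Set (ℝ × ℝ)) (g : ℝ × ℝ → ℝ) (φ : ℕ → PlaneTest) : Prop where
  support : ∀ n, tsupport (φ n) ⊆ D
  bounded : ∃ M : ℝ, ∀ n p, |φ n p| ≤ M
  tendsto : ∀ᵐ p ∂(volume : Measure (ℝ × ℝ)), Tendsto (fun n => φ n p) atTop (𝓝 (g p))

lemma IsApproximating.isTestApprox {D A : Set (ℝ × ℝ)} {φ : ℕ → PlaneTest}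
    (h : IsApproximating D A φ) : IsTestApprox D (A.indicator fun _ => 1) φ :=
  ⟨h.support, h.bounded, h.tendsto⟩

lemma tsupport_linearCombination_subset {D : Set (ℝ × ℝ)} {φ ψ : PlaneTest}
    (hφ : tsupport φ ⊆ D) (hψ : tsupport ψ ⊆ D) (a b : ℝ) :
    tsupport (a • φ + b • ψ : PlaneTest) ⊆ D := by
  have h_left : tsupport (fun x => a • φ x) ⊆ tsupport φ :=
    tsupport_smul_subset_right (fun _ => a) φ
  have h_right : tsupport (fun x => b • ψ x) ⊆ tsupport ψ :=
    tsupport_smul_subset_right (fun _ => b) ψ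
  exact (tsupport_add (fun x => a • φ x) (fun x => b • ψ x)).trans
    (union_subset (h_left.trans hφ) (h_right.trans hψ))

lemma IsTestApprox.linearCombination {D : Set (ℝ × ℝ)} {g h : ℝ × ℝ → ℝ} {φ ψ : ℕ → PlaneTest}
    (hφ : IsTestApprox D g φ) (hψ : IsTestApprox D h ψ) (a b : ℝ) :
    IsTestApprox D (fun p => a * g p + b * h p) (fun n => a • φ n + b • ψ n) := by
  obtain ⟨M, hM⟩ := hφ.bounded
  obtain ⟨N, hN⟩ := hψ.bounded
  refine ⟨fun n => tsupport_linearCombination_subset (hφ.support n) (hψ.support n) a b,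
    ⟨|a| * M + |b| * N, fun n p => ?_⟩, ?_⟩
  · calc |a * φ n p + b * ψ n p| ≤ |a| * |φ n p| + |b| * |ψ n p| := by
          simpa only [abs_mul] using abs_add_le (a * φ n p) (b * ψ n p)
      _ ≤ |a| * M + |b| * N := by
          gcongr
          exacts [hM n p, hN n p]
  · filter_upwards [hφ.tendsto, hψ.tendsto] with p hp hp'
    exact (hp.const_mul a).add (hp'.const_mul b)

lemma IsTestApprox.congr {D : Set (ℝ × ℝ)} {g h : ℝ × ℝ → ℝ} {φ : ℕ → PlaneTest}
    (hφ : IsTestApprox D g φ) (hgh : g =ᵐ[volume] h) : IsTestApprox D h φ := by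
  refine ⟨hφ.support, hφ.bounded, ?_⟩
  filter_upwards [hφ.tendsto, hgh] with p hp h_eq
  rwa [← h_eq]

section WienerIntegral

variable {Ω : Type*} [MeasurableSpace Ω] {P : Measure Ω} {Y : PlaneTest → Ω → ℝ}
  {D : Set (ℝ × ℝ)} {m : Measure ((ℝ × ℝ) × (ℝ × ℝ))} {g h : ℝ × ℝ → ℝ} {ξ ζ : Ω → ℝ}

variable (P Y D) in
/-- The random variable `ξ` is (a version of) the Wiener integral of `g` against the noise `Y` on
`D`: the limit in `L²` of `Y (φ n)` along some sequence of test functions approximating `g`. -/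
structure IsWienerIntegral (g : ℝ × ℝ → ℝ) (ξ : Ω → ℝ) : Prop where
  memLp : MemLp ξ 2 P
  exists_approx : ∃ φ, IsTestApprox D g φ ∧
    Tendsto (fun n => eLpNorm (Y (φ n) - ξ) 2 P) atTop (𝓝 0)

lemma IsWienerIntegral.congr (hξ : IsWienerIntegral P Y D g ξ) (hgh : g =ᵐ[volume] h) :
    IsWienerIntegral P Y D h ξ := by
  obtain ⟨φ, hφ, hlim⟩ := hξ.exists_approx
  exact ⟨hξ.memLp, φ, hφ.congr hgh, hlim⟩

lemma IsRotatedNoiseOfSet.isWienerIntegral {X : PlaneTest → Ω → ℝ} {A : Set (ℝ × ℝ)}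
    (hξ : IsRotatedNoiseOfSet P X D A ξ) :
    IsWienerIntegral P (rotatedNoise X) D (A.indicator fun _ => 1) ξ := by
  obtain ⟨φ, hφ⟩ := hξ.exists_approx
  exact ⟨hξ.memLp, φ, hφ.isTestApprox, hξ.tendsto φ hφ⟩

variable (P Y D m) in
/-- On test functions supported in `D`, the centered Gaussian variables `Y φ` have covariance
`(φ, ψ) ↦ ∫ φ ⊗ ψ ∂m`, for a finite measure `m` without singular part. -/
structure HasCovMeasure : Prop where
  gaussian : ∀ φ, HasGaussianLaw (Y φ) P
  centered : ∀ φ, ∫ ω, Y φ ω ∂P = 0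
  cov : ∀ φ ψ : PlaneTest, tsupport φ ⊆ D → tsupport ψ ⊆ D →
    ∫ ω, Y φ ω * Y ψ ω ∂P = ∫ z, φ z.1 * ψ z.2 ∂m
  finite : IsFiniteMeasure m
  ac : m ≪ volume

namespace HasCovMeasure

variable (hY : HasCovMeasure P Y D m)
include hY

lemma memLp_two (φ : PlaneTest) : MemLp (Y φ) 2 P :=
  (hY.gaussian φ).memLp_two

lemma integral_sum_mul_sum {ι : Type*} [Fintype ι] (c : ι → ℝ)
    (φ : ι → PlaneTest) (hφ : ∀ i, tsupport (φ i) ⊆ D) :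
    ∫ ω, (∑ i, c i * Y (φ i) ω) * (∑ i, c i * Y (φ i) ω) ∂P =
      ∫ z, (∑ i, c i * φ i z.1) * (∑ i, c i * φ i z.2) ∂m := by
  have := hY.finite
  have h_left : ∀ i j, Integrable (fun ω => c i * c j * (Y (φ i) ω * Y (φ j) ω)) P := fun i j =>
    ((hY.memLp_two (φ i)).integrable_mul (hY.memLp_two (φ j))).const_mul _
  have h_right : ∀ i j, Integrable (fun z => c i * c j * (φ i z.1 * φ j z.2)) m := fun i j =>
    (integrable_mul_prod m (φ i) (φ j)).const_mul _
  simp only [Finset.sum_mul_sum, mul_mul_mul_comm]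
  rw [integral_finsetSum _ fun i _ => integrable_finsetSum _ fun j _ => h_left i j,
    integral_finsetSum _ fun i _ => integrable_finsetSum _ fun j _ => h_right i j]
  refine Finset.sum_congr rfl fun i _ => ?_
  rw [integral_finsetSum _ fun j _ => h_left i j, integral_finsetSum _ fun j _ => h_right i j]
  refine Finset.sum_congr rfl fun j _ => ?_
  rw [integral_const_mul, integral_const_mul, hY.cov _ _ (hφ i) (hφ j)]

-- Linearity of `Y` is not assumed: the covariance forces the defect to have variance zero.
lemma map_linearCombination {φ ψ : PlaneTest} (hφ : tsupport φ ⊆ D) (hψ : tsupport ψ ⊆ D)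
    (a b : ℝ) : Y (a • φ + b • ψ) =ᵐ[P] fun ω => a * Y φ ω + b * Y ψ ω := by
  set defect : Ω → ℝ := fun ω => 1 * Y (a • φ + b • ψ) ω + -a * Y φ ω + -b * Y ψ ω
  have h_memLp : MemLp defect 2 P :=
    (((hY.memLp_two _).const_mul 1).add ((hY.memLp_two φ).const_mul (-a))).add
      ((hY.memLp_two ψ).const_mul (-b))
  have h_zero : ∫ ω, defect ω * defect ω ∂P = 0 := by
    have h_test : ∀ p, (a • φ + b • ψ : PlaneTest) p = a * φ p + b * ψ p := fun p => rfl
    have h_defect : ∀ p, 1 * (a * φ p + b * ψ p) + -a * φ p + -b * ψ p = 0 := fun p => by ring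
    have h_cov := hY.integral_sum_mul_sum ![1, -a, -b] ![a • φ + b • ψ, φ, ψ] fun i => by
      fin_cases i
      exacts [tsupport_linearCombination_subset hφ hψ a b, hφ, hψ]
    simpa only [Fin.sum_univ_three, Matrix.cons_val_zero, Matrix.cons_val_one, Matrix.cons_val,
      h_test, h_defect, mul_zero, integral_zero] using h_cov
  rw [integral_eq_zero_iff_of_nonneg (fun _ => mul_self_nonneg _)
    (h_memLp.integrable_mul h_memLp)] at h_zero
  filter_upwards [h_zero] with ω hω
  linarith [mul_self_eq_zero.1 hω]

lemma lintegral_enorm_pow_test {φ : PlaneTest} (hφ : tsupport φ ⊆ D) (k : ℕ) :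
    ∫⁻ ω, ‖Y φ ω‖ₑ ^ (2 * k) ∂P =
      gaussMoment k * ENNReal.ofReal (∫ z, φ z.1 * φ z.2 ∂m) ^ k := by
  rw [lintegral_enorm_pow_of_hasGaussianLaw (hY.gaussian φ) (hY.centered φ), hY.cov _ _ hφ hφ]

lemma tendsto_lintegral_enorm_pow {φ : ℕ → PlaneTest} (hφ : IsTestApprox D g φ) (k : ℕ) :
    Tendsto (fun n => ∫⁻ ω, ‖Y (φ n) ω‖ₑ ^ (2 * k) ∂P) atTop
      (𝓝 (gaussMoment k * ENNReal.ofReal (∫ z, g z.1 * g z.2 ∂m) ^ k)) := by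
  have := hY.finite
  obtain ⟨M, hM⟩ := hφ.bounded
  simp only [fun n => hY.lintegral_enorm_pow_test (hφ.support n) k]
  exact ENNReal.Tendsto.const_mul (ENNReal.Tendsto.pow (ENNReal.tendsto_ofReal
    (tendsto_integral_mul_prod hY.ac (fun n => (φ n).continuous.measurable) hM hφ.tendsto)))
    (Or.inr (gaussMoment_lt_top k).ne)

lemma lintegral_enorm_pow_le (hξ : IsWienerIntegral P Y D g ξ) (k : ℕ) :
    ∫⁻ ω, ‖ξ ω‖ₑ ^ (2 * k) ∂P ≤
      gaussMoment k * ENNReal.ofReal (∫ z, g z.1 * g z.2 ∂m) ^ k := by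
  obtain ⟨φ, hφ, hlim⟩ := hξ.exists_approx
  obtain ⟨ns, hns, h_ae⟩ := (tendstoInMeasure_of_tendsto_eLpNorm two_ne_zero
    (fun n => (hY.memLp_two (φ n)).1) hξ.memLp.1 hlim).exists_seq_tendsto_ae
  calc ∫⁻ ω, ‖ξ ω‖ₑ ^ (2 * k) ∂P
      = ∫⁻ ω, liminf (fun i => ‖Y (φ (ns i)) ω‖ₑ ^ (2 * k)) atTop ∂P := by
        refine lintegral_congr_ae ?_
        filter_upwards [h_ae] with ω hω
        exact (ENNReal.Tendsto.pow hω.enorm).liminf_eq.symm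
    _ ≤ liminf (fun i => ∫⁻ ω, ‖Y (φ (ns i)) ω‖ₑ ^ (2 * k) ∂P) atTop :=
        lintegral_liminf_le' fun i =>
          ((hY.gaussian (φ (ns i))).aemeasurable.enorm.pow_const _)
    _ = gaussMoment k * ENNReal.ofReal (∫ z, g z.1 * g z.2 ∂m) ^ k :=
        ((hY.tendsto_lintegral_enorm_pow hφ k).comp hns.tendsto_atTop).liminf_eq

lemma isWienerIntegral_linearCombination (hξ : IsWienerIntegral P Y D g ξ)
    (hζ : IsWienerIntegral P Y D h ζ) (a b : ℝ) :
    IsWienerIntegral P Y D (fun p => a * g p + b * h p) (fun ω => a * ξ ω + b * ζ ω) := by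
  obtain ⟨φ, hφ, hφlim⟩ := hξ.exists_approx
  obtain ⟨ψ, hψ, hψlim⟩ := hζ.exists_approx
  refine ⟨(hξ.memLp.const_mul a).add (hζ.memLp.const_mul b), _, hφ.linearCombination hψ a b, ?_⟩
  have h_bound : Tendsto (fun n => ‖a‖ₑ * eLpNorm (Y (φ n) - ξ) 2 P +
      ‖b‖ₑ * eLpNorm (Y (ψ n) - ζ) 2 P) atTop (𝓝 0) := by
    simpa using (ENNReal.Tendsto.const_mul (a := ‖a‖ₑ) hφlim (Or.inr enorm_ne_top)).add
      (ENNReal.Tendsto.const_mul (a := ‖b‖ₑ) hψlim (Or.inr enorm_ne_top))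
  refine tendsto_of_tendsto_of_tendsto_of_le_of_le tendsto_const_nhds h_bound
    (fun _ => zero_le) fun n => ?_
  have h_ae : Y (a • φ n + b • ψ n) - (fun ω => a * ξ ω + b * ζ ω) =ᵐ[P]
      a • (Y (φ n) - ξ) + b • (Y (ψ n) - ζ) := by
    filter_upwards [hY.map_linearCombination (hφ.support n) (hψ.support n) a b] with ω hω
    simp only [Pi.sub_apply, Pi.add_apply, Pi.smul_apply, smul_eq_mul, hω]
    ring
  beta_reduce
  rw [eLpNorm_congr_ae h_ae, ← eLpNorm_const_smul, ← eLpNorm_const_smul]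
  exact eLpNorm_add_le (((hY.memLp_two _).sub hξ.memLp).const_smul a).1
    (((hY.memLp_two _).sub hζ.memLp).const_smul b).1 one_le_two

lemma ae_eq_zero_of_isWienerIntegral (hξ : IsWienerIntegral P Y D g ξ)
    (hg : ∫ z, g z.1 * g z.2 ∂m = 0) : ξ =ᵐ[P] 0 := by
  have h_le := hY.lintegral_enorm_pow_le hξ 1
  rw [hg, ENNReal.ofReal_zero, pow_one, mul_zero, nonpos_iff_eq_zero, mul_one,
    lintegral_eq_zero_iff' (hξ.memLp.1.enorm.pow_const 2)] at h_le
  filter_upwards [h_le] with ω hω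
  simpa using hω

lemma ae_eq_of_isWienerIntegral (hξ : IsWienerIntegral P Y D g ξ)
    (hζ : IsWienerIntegral P Y D g ζ) : ξ =ᵐ[P] ζ := by
  have h_sub := hY.isWienerIntegral_linearCombination hξ hζ 1 (-1)
  filter_upwards [hY.ae_eq_zero_of_isWienerIntegral h_sub (by simp)] with ω hω
  simp only [Pi.zero_apply] at hω
  linarith

lemma eLpNorm_sub {φ ψ : PlaneTest} (hφ : tsupport φ ⊆ D) (hψ : tsupport ψ ⊆ D) :
    eLpNorm (Y φ - Y ψ) 2 P = ENNReal.ofReal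
      ((∫ z, (φ z.1 - ψ z.1) * (φ z.2 - ψ z.2) ∂m) ^ (2 : ℝ)⁻¹) := by
  have h_cov := hY.integral_sum_mul_sum ![1, -1] ![φ, ψ] fun i => by
    fin_cases i
    exacts [hφ, hψ]
  simp only [Fin.sum_univ_two, Matrix.cons_val_zero, Matrix.cons_val_one, one_mul, neg_mul,
    ← sub_eq_add_neg] at h_cov
  rw [((hY.memLp_two φ).sub (hY.memLp_two ψ)).eLpNorm_eq_integral_rpow_norm two_ne_zero
    ENNReal.ofNat_ne_top, ← h_cov]
  simp [sq]

lemma cauchySeq_toLp {φ : ℕ → PlaneTest} (hφ : IsTestApprox D g φ) :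
    CauchySeq fun n => (hY.memLp_two (φ n)).toLp (Y (φ n)) := by
  have := hY.finite
  obtain ⟨M, hM⟩ := hφ.bounded
  have h_diff : ∀ᵐ p ∂(volume : Measure (ℝ × ℝ)),
      Tendsto (fun n : ℕ × ℕ => φ n.1 p - φ n.2 p) atTop (𝓝 0) := by
    filter_upwards [hφ.tendsto] with p hp
    rw [← prod_atTop_atTop_eq, ← sub_self (g p)]
    exact (hp.comp tendsto_fst).sub (hp.comp tendsto_snd)
  have h_cov : Tendsto (fun n : ℕ × ℕ => ∫ z, (φ n.1 z.1 - φ n.2 z.1) * (φ n.1 z.2 - φ n.2 z.2) ∂m)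
      atTop (𝓝 0) := by
    simpa only [mul_zero, integral_zero] using tendsto_integral_mul_prod
      (f := fun (n : ℕ × ℕ) p => φ n.1 p - φ n.2 p) (g := fun _ => 0) (M := M + M) hY.ac
      (fun n => (φ n.1).continuous.measurable.sub (φ n.2).continuous.measurable)
      (fun n p => (abs_sub _ _).trans (add_le_add (hM _ _) (hM _ _))) h_diff
  have : Fact ((1 : ℝ≥0∞) ≤ 2) := ⟨one_le_two⟩
  rw [Lp.cauchySeq_Lp_iff_cauchySeq_eLpNorm]
  have h_norm : ∀ n : ℕ × ℕ, eLpNorm (⇑((hY.memLp_two (φ n.1)).toLp (Y (φ n.1))) -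
      ⇑((hY.memLp_two (φ n.2)).toLp (Y (φ n.2)))) 2 P = ENNReal.ofReal
        ((∫ z, (φ n.1 z.1 - φ n.2 z.1) * (φ n.1 z.2 - φ n.2 z.2) ∂m) ^ (2 : ℝ)⁻¹) := fun n => by
    rw [← hY.eLpNorm_sub (hφ.support n.1) (hφ.support n.2)]
    exact eLpNorm_congr_ae
      ((hY.memLp_two (φ n.1)).coeFn_toLp.sub (hY.memLp_two (φ n.2)).coeFn_toLp)
  simp only [h_norm]
  simpa using ENNReal.tendsto_ofReal (h_cov.rpow_const (p := (2 : ℝ)⁻¹) (Or.inr (by norm_num)))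

lemma exists_tendsto_eLpNorm {φ : ℕ → PlaneTest} (hφ : IsTestApprox D g φ) :
    ∃ ξ, MemLp ξ 2 P ∧ Tendsto (fun n => eLpNorm (Y (φ n) - ξ) 2 P) atTop (𝓝 0) := by
  have : Fact ((1 : ℝ≥0∞) ≤ 2) := ⟨one_le_two⟩
  obtain ⟨ξ, hξ⟩ := cauchySeq_tendsto_of_complete (hY.cauchySeq_toLp hφ)
  rw [Lp.tendsto_Lp_iff_tendsto_eLpNorm'] at hξ
  exact ⟨ξ, Lp.memLp ξ, hξ.congr fun n =>
    eLpNorm_congr_ae ((hY.memLp_two (φ n)).coeFn_toLp.sub (EventuallyEq.refl _ _))⟩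

lemma tendsto_eLpNorm_of_isWienerIntegral (hξ : IsWienerIntegral P Y D g ξ) {φ : ℕ → PlaneTest}
    (hφ : IsTestApprox D g φ) : Tendsto (fun n => eLpNorm (Y (φ n) - ξ) 2 P) atTop (𝓝 0) := by
  obtain ⟨ζ, hζ, hlim⟩ := hY.exists_tendsto_eLpNorm hφ
  have h_eq := hY.ae_eq_of_isWienerIntegral hξ ⟨hζ, φ, hφ, hlim⟩
  exact hlim.congr fun n => eLpNorm_congr_ae ((EventuallyEq.refl _ _).sub h_eq.symm)

end HasCovMeasure

end WienerIntegral

section WienerIntegralBound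

variable {Ω : Type*} [MeasurableSpace Ω] {P : Measure Ω} {Y : PlaneTest → Ω → ℝ}
  {D : Set (ℝ × ℝ)} {m : Measure ((ℝ × ℝ) × (ℝ × ℝ))} {g : ℝ × ℝ → ℝ} {ξ : Ω → ℝ}

lemma ofReal_integral_mul_prod_le {A : Set (ℝ × ℝ)} (hg : ∀ p, |g p| ≤ A.indicator 1 p) :
    ENNReal.ofReal (∫ z, g z.1 * g z.2 ∂m) ≤ m (A ×ˢ A) := by
  have h_enorm : ∀ p, ‖g p‖ₑ ≤ A.indicator 1 p := fun p => by
    rw [Real.enorm_eq_ofReal_abs]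
    refine (ENNReal.ofReal_le_ofReal (hg p)).trans_eq ?_
    by_cases hp : p ∈ A <;> simp [hp]
  calc ENNReal.ofReal (∫ z, g z.1 * g z.2 ∂m)
      ≤ ‖∫ z, g z.1 * g z.2 ∂m‖ₑ := by
        rw [Real.enorm_eq_ofReal_abs]
        exact ENNReal.ofReal_le_ofReal (le_abs_self _)
    _ ≤ ∫⁻ z, ‖g z.1 * g z.2‖ₑ ∂m := enorm_integral_le_lintegral_enorm _
    _ ≤ ∫⁻ z, (A ×ˢ A).indicator 1 z ∂m := by
        refine lintegral_mono fun z => ?_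
        rw [enorm_mul]
        refine (mul_le_mul' (h_enorm z.1) (h_enorm z.2)).trans_eq ?_
        by_cases h_fst : z.1 ∈ A <;> by_cases h_snd : z.2 ∈ A <;> simp [indicator, h_fst, h_snd]
    _ ≤ m (A ×ˢ A) := lintegral_indicator_one_le _

namespace HasCovMeasure

variable (hY : HasCovMeasure P Y D m)
include hY

lemma lintegral_enorm_pow_le_measure (hξ : IsWienerIntegral P Y D g ξ) {A : Set (ℝ × ℝ)}
    (hg : ∀ p, |g p| ≤ A.indicator 1 p) (k : ℕ) :
    ∫⁻ ω, ‖ξ ω‖ₑ ^ (2 * k) ∂P ≤ gaussMoment k * m (A ×ˢ A) ^ k := by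
  refine (hY.lintegral_enorm_pow_le hξ k).trans ?_
  gcongr
  exact ofReal_integral_mul_prod_le hg

lemma isWienerIntegral_rectIncr {G : ℝ × ℝ → ℝ × ℝ → ℝ} {W : ℝ × ℝ → Ω → ℝ}
    (hW : ∀ p, IsWienerIntegral P Y D (G p) (W p)) (s₁ s₂ t₁ t₂ : ℝ) :
    IsWienerIntegral P Y D (fun x => rectIncr (fun p => G p x) s₁ s₂ t₁ t₂)
      (fun ω => rectIncr (fun p => W p ω) s₁ s₂ t₁ t₂) := by
  have h_edge := fun s => hY.isWienerIntegral_linearCombination (hW (s, t₂)) (hW (s, t₁)) 1 (-1)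
  convert hY.isWienerIntegral_linearCombination (h_edge s₂) (h_edge s₁) 1 (-1) using 1 <;>
  · funext
    rw [rectIncr]
    ring

lemma tendstoInMeasure_of_isWienerIntegral {ι : Type*} {l : Filter ι} [l.IsCountablyGenerated]
    {f : ι → ℝ × ℝ → ℝ} {ζ : ι → Ω → ℝ} (hζ : ∀ i, IsWienerIntegral P Y D (f i) (ζ i))
    (hξ : IsWienerIntegral P Y D g ξ) (hf : ∀ i, Measurable (f i)) (hg : Measurable g)
    {M : ℝ} (hM : ∀ i p, |f i p - g p| ≤ M)
    (h_lim : ∀ᵐ p ∂(volume : Measure (ℝ × ℝ)), Tendsto (fun i => f i p) l (𝓝 (g p))) :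
    TendstoInMeasure P ζ l ξ := by
  have := hY.finite
  have h_cov : Tendsto (fun i => ∫ z, (f i z.1 - g z.1) * (f i z.2 - g z.2) ∂m) l (𝓝 0) := by
    simpa only [mul_zero, integral_zero] using tendsto_integral_mul_prod
      (f := fun i p => f i p - g p) (g := fun _ => 0) hY.ac (fun i => (hf i).sub hg) hM
      (h_lim.mono fun p hp => by simpa only [sub_self] using hp.sub_const (g p))
  have h_bound : ∀ i, ∫⁻ ω, ‖ζ i ω - ξ ω‖ₑ ^ (2 * 1) ∂P ≤ gaussMoment 1 *
      ENNReal.ofReal (∫ z, (f i z.1 - g z.1) * (f i z.2 - g z.2) ∂m) ^ 1 := fun i => by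
    simpa only [one_mul, neg_mul, ← sub_eq_add_neg] using
      hY.lintegral_enorm_pow_le (hY.isWienerIntegral_linearCombination (hζ i) hξ 1 (-1)) 1
  have h_sq : Tendsto (fun i => ∫⁻ ω, ‖ζ i ω - ξ ω‖ₑ ^ (2 * 1) ∂P) l (𝓝 0) := by
    refine tendsto_of_tendsto_of_tendsto_of_le_of_le tendsto_const_nhds ?_ (fun _ => zero_le)
      h_bound
    simpa using ENNReal.Tendsto.const_mul (a := gaussMoment 1) (ENNReal.tendsto_ofReal h_cov)
      (Or.inr (gaussMoment_lt_top 1).ne)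
  refine tendstoInMeasure_of_tendsto_eLpNorm two_ne_zero (fun i => (hζ i).memLp.1) hξ.memLp.1 ?_
  have h_sqrt := h_sq.ennrpow_const (1 / 2 : ℝ)
  rw [ENNReal.zero_rpow_of_pos (by norm_num)] at h_sqrt
  refine h_sqrt.congr fun i => ?_
  rw [eLpNorm_eq_lintegral_rpow_enorm_toReal two_ne_zero (by norm_num)]
  simp

end HasCovMeasure

lemma HasCovMeasure.exists_isRotatedNoiseOfSet {X : PlaneTest → Ω → ℝ}
    (hX : HasCovMeasure P (rotatedNoise X) D m) {A : Set (ℝ × ℝ)}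
    (hA : ∃ φ, IsApproximating D A φ) : ∃ ξ, IsRotatedNoiseOfSet P X D A ξ := by
  obtain ⟨φ, hφ⟩ := hA
  obtain ⟨ξ, hξ, hlim⟩ := hX.exists_tendsto_eLpNorm hφ.isTestApprox
  exact ⟨ξ, hξ, ⟨φ, hφ⟩, fun ψ hψ =>
    hX.tendsto_eLpNorm_of_isWienerIntegral ⟨hξ, φ, hφ.isTestApprox, hlim⟩ hψ.isTestApprox⟩

end WienerIntegralBound

open scoped Manifold ContDiff in
lemma exists_planeTest_eq_one {K A : Set (ℝ × ℝ)} (hK : IsClosed K) (hA : IsCompact A)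
    (hKA : K ⊆ interior A) : ∃ φ : PlaneTest, tsupport φ ⊆ A ∧ (∀ p, φ p ∈ Icc (0 : ℝ) 1) ∧
      (∀ p ∈ K, φ p = 1) ∧ ∀ p ∉ interior A, φ p = 0 := by
  obtain ⟨f, h_one, h_zero, h_range⟩ := exists_contMDiffMap_one_nhds_of_subset_interior
    𝓘(ℝ, ℝ × ℝ) (n := ⊤) hK (hKA.trans interior_interior.symm.subset)
  have h_supp : tsupport f ⊆ A := closure_minimal (fun p hp => by
    by_contra hpA
    exact hp (h_zero p fun h => hpA (interior_subset h))) hA.isClosed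
  exact ⟨⟨f, f.contMDiff.contDiff, hA.of_isClosed_subset (isClosed_tsupport f) h_supp,
    fun _ _ => trivial⟩, h_supp, h_range, fun p hp => h_one.self_of_nhdsSet p hp, h_zero⟩

lemma exists_isApproximating {D A : Set (ℝ × ℝ)} (hA : IsCompact A) (hconv : Convex ℝ A)
    (hAD : A ⊆ D) : ∃ φ, IsApproximating D A φ := by
  obtain ⟨F, hF_closed, hF_sub, hF_union, hF_mono⟩ :=
    (isOpen_interior (s := A)).exists_iUnion_isClosed
  choose φ hφ_supp hφ_range hφ_one hφ_zero using
    fun n => exists_planeTest_eq_one (hF_closed n) hA (hF_sub n)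
  refine ⟨φ, fun n => (hφ_supp n).trans hAD, ⟨1, fun n p => ?_⟩, ?_⟩
  · rw [abs_of_nonneg (hφ_range n p).1]
    exact (hφ_range n p).2
  have h_frontier : ∀ᵐ p ∂(volume : Measure (ℝ × ℝ)), p ∉ frontier A :=
    measure_eq_zero_iff_ae_notMem.1 (hconv.addHaar_frontier volume)
  filter_upwards [h_frontier] with p hp
  by_cases hp_int : p ∈ interior A
  · rw [indicator_of_mem (interior_subset hp_int)]
    obtain ⟨N, hN⟩ := mem_iUnion.1 (hF_union.symm ▸ hp_int)
    refine tendsto_const_nhds.congr' ?_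
    filter_upwards [eventually_ge_atTop N] with n hn
    exact (hφ_one n p (hF_mono hn hN)).symm
  · have hpA : p ∉ A := fun h => hp ⟨subset_closure h, hp_int⟩
    simp only [indicator_of_notMem hpA, fun n => hφ_zero n p hp_int, tendsto_const_nhds]

/-! ### Dyadic chaining -/

/-- The dyadic approximation from below of a real number at level `n`. -/
def dyadicFloor (n : ℕ) (s : ℝ) : ℝ := ⌊(2 : ℝ) ^ n * s⌋ / 2 ^ n

/-- The set of dyadic numbers. -/
def dyadics : Set ℝ := {s | ∃ (n : ℕ) (i : ℤ), s = i / 2 ^ n}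

lemma countable_dyadics : dyadics.Countable := by
  refine (countable_range fun I : ℕ × ℤ => (I.2 : ℝ) / 2 ^ I.1).mono ?_
  rintro _ ⟨n, i, rfl⟩
  exact mem_range_self (n, i)

lemma dyadicFloor_mem (n : ℕ) (s : ℝ) : dyadicFloor n s ∈ dyadics := ⟨n, _, rfl⟩

lemma zero_mem_dyadics : (0 : ℝ) ∈ dyadics := ⟨0, 0, by simp⟩

lemma dyadicFloor_zero (n : ℕ) : dyadicFloor n 0 = 0 := by simp [dyadicFloor]

lemma dyadicFloor_le (n : ℕ) (s : ℝ) : dyadicFloor n s ≤ s := by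
  rw [dyadicFloor, div_le_iff₀ (by positivity), mul_comm s]
  exact Int.floor_le _

lemma sub_lt_dyadicFloor (n : ℕ) (s : ℝ) : s - (1 / 2) ^ n < dyadicFloor n s := by
  rw [dyadicFloor, lt_div_iff₀ (by positivity), sub_mul, ← mul_pow, one_div_mul_cancel two_ne_zero,
    one_pow, mul_comm s]
  exact Int.sub_one_lt_floor _

lemma tendsto_dyadicFloor (s : ℝ) : Tendsto (fun n => dyadicFloor n s) atTop (𝓝 s) := by
  refine tendsto_of_tendsto_of_tendsto_of_le_of_le (g := fun n : ℕ => s - (1 / 2 : ℝ) ^ n) ?_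
    tendsto_const_nhds (fun n => (sub_lt_dyadicFloor n s).le) (fun n => dyadicFloor_le n s)
  simpa using tendsto_const_nhds.sub
    (tendsto_pow_atTop_nhds_zero_of_lt_one (r := (1 / 2 : ℝ)) (by norm_num) (by norm_num))

lemma abs_dyadicFloor_sub_le (n : ℕ) (s : ℝ) : |dyadicFloor n s - s| ≤ 1 := by
  have h_pow : (1 / 2 : ℝ) ^ n ≤ 1 := pow_le_one₀ (by norm_num) (by norm_num)
  rw [abs_le]
  constructor <;> linarith [dyadicFloor_le n s, sub_lt_dyadicFloor n s]

lemma dyadicFloor_eq_of_le {N n : ℕ} (i : ℤ) (h : N ≤ n) :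
    dyadicFloor n ((i : ℝ) / 2 ^ N) = i / 2 ^ N := by
  obtain ⟨k, rfl⟩ := Nat.exists_eq_add_of_le h
  have h_int : (2 : ℝ) ^ (N + k) * (i / 2 ^ N) = ((i * 2 ^ k : ℤ) : ℝ) := by
    push_cast
    rw [pow_add]
    field_simp
  rw [dyadicFloor, h_int, Int.floor_intCast]
  push_cast
  rw [pow_add]
  field_simp

lemma floor_two_mul_eq (x : ℝ) : ⌊2 * x⌋ = 2 * ⌊x⌋ ∨ ⌊2 * x⌋ = 2 * ⌊x⌋ + 1 := by
  have h_ge : 2 * ⌊x⌋ ≤ ⌊2 * x⌋ := by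
    rw [Int.le_floor]
    push_cast
    linarith [Int.floor_le x]
  have h_lt : ⌊2 * x⌋ < 2 * ⌊x⌋ + 2 := by
    rw [Int.floor_lt]
    push_cast
    linarith [Int.lt_floor_add_one x]
  omega

lemma dyadicFloor_succ_eq (n : ℕ) (s : ℝ) : ∃ i : ℤ, dyadicFloor n s = i / 2 ^ (n + 1) ∧
    (dyadicFloor (n + 1) s = i / 2 ^ (n + 1) ∨
      dyadicFloor (n + 1) s = ((i : ℝ) + 1) / 2 ^ (n + 1)) := by
  refine ⟨2 * ⌊(2 : ℝ) ^ n * s⌋, ?_, ?_⟩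
  · rw [dyadicFloor]
    push_cast
    rw [pow_succ]
    field_simp
  · rw [dyadicFloor, pow_succ', mul_assoc]
    rcases floor_two_mul_eq ((2 : ℝ) ^ n * s) with h | h
    · exact Or.inl (by rw [h])
    · exact Or.inr (by rw [h, Int.cast_add, Int.cast_one])

/-- Between neighbouring dyadic numbers of level `n`, the function `f` moves by at most
`K (2⁻ⁿ) ^ η`. -/
def DyadicStepBound {E : Type*} [PseudoMetricSpace E] (η K : ℝ) (f : ℝ → E) : Prop :=
  ∀ (n : ℕ) (i : ℤ), dist (f (i / 2 ^ n)) (f (((i : ℝ) + 1) / 2 ^ n)) ≤ K * ((1 / 2 : ℝ) ^ n) ^ η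

/-- The constant in the dyadic Hölder estimate on intervals of length at most `L`. -/
def dyadicConst (η L : ℝ) : ℝ :=
  2 / (1 - (1 / 2 : ℝ) ^ η) + (max L 1 + 1) / (1 / 2 : ℝ) ^ η

lemma half_rpow_lt_one {η : ℝ} (hη : 0 < η) : (1 / 2 : ℝ) ^ η < 1 :=
  Real.rpow_lt_one (by norm_num) (by norm_num) hη

lemma dyadicConst_nonneg {η : ℝ} (hη : 0 < η) (L : ℝ) : 0 ≤ dyadicConst η L := by
  have h_pos : 0 < 1 - (1 / 2 : ℝ) ^ η := sub_pos.2 (half_rpow_lt_one hη)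
  unfold dyadicConst
  positivity

lemma exists_dyadic_scale {d L : ℝ} (hd : 0 < d) (hdL : d ≤ L) :
    ∃ n : ℕ, 2 ^ n * d ≤ max L 1 ∧ (1 / 2) ^ (n + 1) ≤ d := by
  rcases le_or_gt d 1 with h | h
  · obtain ⟨n, hn, hn'⟩ := exists_nat_pow_near_of_lt_one hd h (y := (1 / 2 : ℝ)) (by norm_num)
      (by norm_num)
    refine ⟨n, ?_, hn.le⟩
    calc 2 ^ n * d ≤ 2 ^ n * (1 / 2) ^ n := by gcongr
      _ = 1 := by rw [← mul_pow, mul_one_div_cancel two_ne_zero, one_pow]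
      _ ≤ max L 1 := le_max_right _ _
  · refine ⟨0, ?_, by norm_num; linarith⟩
    simpa using Or.inl hdL

namespace DyadicStepBound

variable {E : Type*} [PseudoMetricSpace E] {f : ℝ → E} {η K : ℝ} (hf : DyadicStepBound η K f)
include hf

lemma nonneg : 0 ≤ K := by
  simpa using dist_nonneg.trans (hf 0 0)

lemma dist_dyadicFloor_succ_le (n : ℕ) (s : ℝ) :
    dist (f (dyadicFloor n s)) (f (dyadicFloor (n + 1) s)) ≤ K * ((1 / 2 : ℝ) ^ (n + 1)) ^ η := by
  have hK := hf.nonneg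
  obtain ⟨i, h_floor, h | h⟩ := dyadicFloor_succ_eq n s
  · rw [h_floor, h, dist_self]
    positivity
  · rw [h_floor, h]
    exact hf (n + 1) i

lemma dist_dyadicFloor_le (hη : 0 < η) (n : ℕ) {s : ℝ} (hs : s ∈ dyadics) :
    dist (f (dyadicFloor n s)) (f s) ≤
      K * ((1 / 2 : ℝ) ^ (n + 1)) ^ η / (1 - (1 / 2 : ℝ) ^ η) := by
  obtain ⟨N, i, rfl⟩ := hs
  have h_tendsto : Tendsto (fun n => f (dyadicFloor n ((i : ℝ) / 2 ^ N))) atTop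
      (𝓝 (f (i / 2 ^ N))) := by
    refine tendsto_const_nhds.congr' ?_
    filter_upwards [eventually_ge_atTop N] with n hn
    rw [dyadicFloor_eq_of_le i hn]
  have h_geom : ∀ n, ((1 / 2 : ℝ) ^ (n + 1)) ^ η = (1 / 2 : ℝ) ^ η * ((1 / 2 : ℝ) ^ η) ^ n :=
    fun n => by rw [← Real.rpow_pow_comm (by norm_num), pow_succ']
  rw [h_geom, ← mul_assoc]
  refine dist_le_of_le_geometric_of_tendsto _ _ (half_rpow_lt_one hη) (fun n => ?_) h_tendsto n
  rw [mul_assoc, ← h_geom]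
  exact hf.dist_dyadicFloor_succ_le n _

lemma dist_add_nat_le (n : ℕ) (i : ℤ) (k : ℕ) :
    dist (f (i / 2 ^ n)) (f (((i : ℝ) + k) / 2 ^ n)) ≤ k * (K * ((1 / 2 : ℝ) ^ n) ^ η) := by
  have h_step : ∀ j : ℕ, dist (f (((i : ℝ) + j) / 2 ^ n)) (f (((i : ℝ) + (j + 1 : ℕ)) / 2 ^ n)) ≤
      K * ((1 / 2 : ℝ) ^ n) ^ η := fun j => by
    simpa [add_assoc] using hf n (i + j)
  simpa using dist_le_range_sum_of_dist_le k fun {j} _ => h_step j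

lemma dist_le_of_scale (hη : 0 < η) {s t k : ℝ} {n : ℕ} (hs : s ∈ dyadics) (ht : t ∈ dyadics)
    (hst : s ≤ t) (hk : 2 ^ n * (t - s) ≤ k) :
    dist (f s) (f t) ≤ (2 / (1 - (1 / 2 : ℝ) ^ η) + (k + 1) / (1 / 2 : ℝ) ^ η) * K *
      ((1 / 2 : ℝ) ^ (n + 1)) ^ η := by
  have hK := hf.nonneg
  obtain ⟨j, hj⟩ : ∃ j : ℕ, ⌊(2 : ℝ) ^ n * t⌋ = ⌊(2 : ℝ) ^ n * s⌋ + j :=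
    (Int.le.dest (Int.floor_le_floor (by gcongr))).imp fun _ h => h.symm
  have hjk : (j : ℝ) ≤ k + 1 := by
    have h_le := Int.floor_le ((2 : ℝ) ^ n * t)
    rw [hj] at h_le
    push_cast at h_le
    linarith [Int.lt_floor_add_one ((2 : ℝ) ^ n * s)]
  have h_floors : dist (f (dyadicFloor n s)) (f (dyadicFloor n t)) ≤
      (k + 1) * (K * ((1 / 2 : ℝ) ^ n) ^ η) := by
    rw [dyadicFloor, dyadicFloor, hj, Int.cast_add, Int.cast_natCast]
    refine (hf.dist_add_nat_le n _ j).trans ?_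
    gcongr
  have h_scale : ((1 / 2 : ℝ) ^ (n + 1)) ^ η = ((1 / 2 : ℝ) ^ n) ^ η * (1 / 2 : ℝ) ^ η := by
    rw [pow_succ, Real.mul_rpow (by positivity) (by norm_num)]
  have h_left := hf.dist_dyadicFloor_le hη n hs
  have h_right := hf.dist_dyadicFloor_le hη n ht
  have h_pos : (1 / 2 : ℝ) ^ η ≠ 0 := by positivity
  rw [dist_comm] at h_left
  calc dist (f s) (f t)
      ≤ dist (f s) (f (dyadicFloor n s)) + dist (f (dyadicFloor n s)) (f (dyadicFloor n t)) +
        dist (f (dyadicFloor n t)) (f t) := dist_triangle4 _ _ _ _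
    _ ≤ _ := add_le_add_three h_left h_floors h_right
    _ = _ := by
        rw [h_scale]
        field_simp
        ring

lemma dist_le (hη : 0 < η) {s t L : ℝ} (hs : s ∈ dyadics) (ht : t ∈ dyadics)
    (hL : |t - s| ≤ L) : dist (f s) (f t) ≤ dyadicConst η L * K * |t - s| ^ η := by
  wlog hst : s ≤ t generalizing s t
  · rw [dist_comm, abs_sub_comm]
    exact this ht hs (abs_sub_comm t s ▸ hL) (le_of_not_ge hst)
  have h_const : 0 ≤ dyadicConst η L * K := mul_nonneg (dyadicConst_nonneg hη L) hf.nonneg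
  rcases hst.eq_or_lt with rfl | hst
  · rw [dist_self]
    positivity
  rw [abs_of_pos (sub_pos.2 hst)] at hL ⊢
  obtain ⟨n, hn, hn'⟩ := exists_dyadic_scale (sub_pos.2 hst) hL
  refine (hf.dist_le_of_scale hη hs ht hst.le hn).trans ?_
  exact mul_le_mul_of_nonneg_left (Real.rpow_le_rpow (by positivity) hn' hη.le) h_const

end DyadicStepBound

/-! ### Rectangular Hölder bounds -/

/-- `f` satisfies a rectangular Hölder bound, locally uniformly, on rectangles whose corners have
their coordinates in `S`. -/
def RectHolderOn (S : Set ℝ) (η η' : ℝ) (f : ℝ × ℝ → ℝ) : Prop :=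
  ∀ L : ℝ, ∃ B : ℝ, 0 ≤ B ∧ ∀ s₁ ∈ S, ∀ s₂ ∈ S, ∀ t₁ ∈ S, ∀ t₂ ∈ S,
    |s₂ - s₁| ≤ L → |t₂ - t₁| ≤ L →
      |rectIncr f s₁ s₂ t₁ t₂| ≤ B * (|s₂ - s₁| ^ η * |t₂ - t₁| ^ η')

/-- `f` vanishes at the points of the coordinate axes whose coordinates lie in `S`; this is what
lets bounds on rectangular increments control `f` itself. -/
structure VanishesOnAxesOn (S : Set ℝ) (f : ℝ × ℝ → ℝ) : Prop where
  left : ∀ t ∈ S, f (0, t) = 0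
  right : ∀ s ∈ S, f (s, 0) = 0

/-- The increment of `f` on the dyadic cell `[i/2ⁿ, (i+1)/2ⁿ] × [j/2ᵐ, (j+1)/2ᵐ]`, where
`I = (n, i)` and `J = (m, j)`. -/
def cellIncr (f : ℝ × ℝ → ℝ) (I J : ℕ × ℤ) : ℝ :=
  rectIncr f (I.2 / 2 ^ I.1) (((I.2 : ℝ) + 1) / 2 ^ I.1) (J.2 / 2 ^ J.1)
    (((J.2 : ℝ) + 1) / 2 ^ J.1)

/-- The rectangular Hölder bound with constant `K` on all dyadic cells. -/
def DyadicCellBound (η η' K : ℝ) (f : ℝ × ℝ → ℝ) : Prop :=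
  ∀ I J, |cellIncr f I J| ≤ K * (((1 / 2 : ℝ) ^ I.1) ^ η * ((1 / 2 : ℝ) ^ J.1) ^ η')

section DyadicCellBound

variable {η η' K : ℝ} {f : ℝ × ℝ → ℝ}

lemma DyadicCellBound.nonneg (hf : DyadicCellBound η η' K f) : 0 ≤ K := by
  simpa using (abs_nonneg _).trans (hf (0, 0) (0, 0))

lemma DyadicCellBound.mono {η₀ η₀' : ℝ} (hf : DyadicCellBound η η' K f) (h : η₀ ≤ η)
    (h' : η₀' ≤ η') : DyadicCellBound η₀ η₀' K f := by
  have hK := hf.nonneg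
  have h_pow : ∀ {n : ℕ} {a b : ℝ}, a ≤ b → ((1 / 2 : ℝ) ^ n) ^ b ≤ ((1 / 2 : ℝ) ^ n) ^ a :=
    fun hab => Real.rpow_le_rpow_of_exponent_ge (by positivity)
      (pow_le_one₀ (by norm_num) (by norm_num)) hab
  intro I J
  refine (hf I J).trans ?_
  gcongr K * (?_ * ?_)
  exacts [h_pow h, h_pow h']

/-- Chaining in the first variable bounds the increments over `[s₁, s₂] × J` for dyadic `J`;
chaining in the second variable then applies to `t ↦ f (s₂, t) - f (s₁, t)`. -/
lemma DyadicCellBound.rectHolderOn (hf : DyadicCellBound η η' K f) (hη : 0 < η) (hη' : 0 < η') :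
    RectHolderOn dyadics η η' f := by
  intro L
  have hK := hf.nonneg
  have h_const := dyadicConst_nonneg hη L
  have h_const' := dyadicConst_nonneg hη' L
  refine ⟨dyadicConst η' L * (dyadicConst η L * K), by positivity,
    fun s₁ hs₁ s₂ hs₂ t₁ ht₁ t₂ ht₂ hs ht => ?_⟩
  have h_first : ∀ m j, DyadicStepBound η (K * ((1 / 2 : ℝ) ^ m) ^ η')
      fun s => f (s, ((j : ℤ) + 1 : ℝ) / 2 ^ m) - f (s, j / 2 ^ m) := fun m j n i => by
    rw [dist_comm, Real.dist_eq]
    calc _ = |cellIncr f (n, i) (m, j)| := by rw [cellIncr, rectIncr]; congr 1; ring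
      _ ≤ _ := hf (n, i) (m, j)
      _ = _ := by ring
  have h_second : DyadicStepBound η' (dyadicConst η L * K * |s₂ - s₁| ^ η)
      fun t => f (s₂, t) - f (s₁, t) := fun m j => by
    have h_le := (h_first m j).dist_le hη hs₁ hs₂ hs
    rw [dist_comm, Real.dist_eq] at h_le ⊢
    calc _ = _ := by congr 1; ring
      _ ≤ _ := h_le
      _ = _ := by ring
  have h_le := h_second.dist_le hη' ht₁ ht₂ ht
  rw [dist_comm, Real.dist_eq] at h_le
  calc |rectIncr f s₁ s₂ t₁ t₂| = _ := by rw [rectIncr]; congr 1; ring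
    _ ≤ _ := h_le
    _ = _ := by ring

end DyadicCellBound

/-- The limit of `f` along dyadic approximations from below. -/
def dyadicLim (f : ℝ × ℝ → ℝ) (p : ℝ × ℝ) : ℝ :=
  limUnder atTop fun n : ℕ => f (dyadicFloor n p.1, dyadicFloor n p.2)

lemma VanishesOnAxesOn.dyadicLim {f : ℝ × ℝ → ℝ} (hf : VanishesOnAxesOn dyadics f) :
    VanishesOnAxesOn univ (dyadicLim f) where
  left t _ := by
    simp only [FracNoise.dyadicLim, dyadicFloor_zero, hf.left _ (dyadicFloor_mem _ _)]
    exact tendsto_const_nhds.limUnder_eq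
  right s _ := by
    simp only [FracNoise.dyadicLim, dyadicFloor_zero, hf.right _ (dyadicFloor_mem _ _)]
    exact tendsto_const_nhds.limUnder_eq

namespace RectHolderOn

variable {S : Set ℝ} {η η' : ℝ} {f : ℝ × ℝ → ℝ}

/-- Since `f` vanishes on the axes, `f (s, t) - f (s', t)` and `f (s', t) - f (s', t')` are the
increments of `f` over the rectangles `[s', s] × [0, t]` and `[0, s'] × [t', t]`. -/
lemma abs_sub_le (hf : RectHolderOn S η η' f) (h_axes : VanishesOnAxesOn S f) (hη : 0 < η)
    (hη' : 0 < η') (hS : (0 : ℝ) ∈ S) (L : ℝ) :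
    ∃ B, ∀ s ∈ S, ∀ t ∈ S, ∀ s' ∈ S, ∀ t' ∈ S, |s| ≤ L → |t| ≤ L → |s'| ≤ L → |t'| ≤ L →
      |f (s, t) - f (s', t')| ≤ B * (|s - s'| ^ η + |t - t'| ^ η') := by
  obtain ⟨B, hB₀, hB⟩ := hf (2 * L)
  refine ⟨B * (L ^ η + L ^ η'), fun s hs t ht s' hs' t' ht' hsL htL hsL' htL' => ?_⟩
  have hL : 0 ≤ L := (abs_nonneg s).trans hsL
  have h_diff : ∀ a b : ℝ, |a| ≤ L → |b| ≤ L → |a - b| ≤ 2 * L := fun a b ha hb =>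
    (abs_sub _ _).trans (by linarith)
  have h_incr := hB s' hs' s hs 0 hS t ht (h_diff _ _ hsL hsL') (by simpa using by linarith)
  have h_incr' := hB 0 hS s' hs' t' ht' t ht (by simpa using by linarith) (h_diff _ _ htL htL')
  simp only [rectIncr, h_axes.left _ ht, h_axes.left _ ht', h_axes.right _ hs, h_axes.right _ hs',
    sub_zero, add_zero] at h_incr h_incr'
  calc |f (s, t) - f (s', t')| ≤ |f (s, t) - f (s', t)| + |f (s', t) - f (s', t')| :=
        _root_.abs_sub_le _ _ _
    _ ≤ B * (|s - s'| ^ η * |t| ^ η') + B * (|s'| ^ η * |t - t'| ^ η') :=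
        add_le_add h_incr h_incr'
    _ ≤ B * (|s - s'| ^ η * L ^ η') + B * (L ^ η * |t - t'| ^ η') := by gcongr
    _ ≤ B * (|s - s'| ^ η * L ^ η') + B * (L ^ η * |t - t'| ^ η') +
        (B * (|s - s'| ^ η * L ^ η) + B * (L ^ η' * |t - t'| ^ η')) :=
        le_add_of_nonneg_right (by positivity)
    _ = _ := by ring

lemma continuous (hf : RectHolderOn univ η η' f) (h_axes : VanishesOnAxesOn univ f) (hη : 0 < η)
    (hη' : 0 < η') : Continuous f := by
  rw [continuous_iff_continuousAt]
  rintro ⟨s, t⟩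
  obtain ⟨B, hB⟩ := hf.abs_sub_le h_axes hη hη' (mem_univ 0) (‖(s, t)‖ + 1)
  have h_bound : Tendsto (fun p : ℝ × ℝ => B * (|p.1 - s| ^ η + |p.2 - t| ^ η')) (𝓝 (s, t))
      (𝓝 0) := by
    have h_cont : Continuous fun p : ℝ × ℝ => B * (|p.1 - s| ^ η + |p.2 - t| ^ η') :=
      continuous_const.mul
        (((continuous_fst.sub continuous_const).abs.rpow_const fun _ => Or.inr hη.le).add
          ((continuous_snd.sub continuous_const).abs.rpow_const fun _ => Or.inr hη'.le))
    simpa [Real.zero_rpow hη.ne', Real.zero_rpow hη'.ne'] using h_cont.tendsto (s, t)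
  rw [ContinuousAt, tendsto_iff_norm_sub_tendsto_zero]
  refine squeeze_zero' (Eventually.of_forall fun _ => norm_nonneg _) ?_ h_bound
  filter_upwards [Metric.ball_mem_nhds (s, t) one_pos] with p hp
  have hp_norm : ‖p‖ ≤ ‖(s, t)‖ + 1 := by
    rw [mem_ball_iff_norm] at hp
    linarith [norm_le_norm_add_norm_sub' p (s, t)]
  have h_norm : ‖(s, t)‖ ≤ ‖(s, t)‖ + 1 := by linarith
  exact hB p.1 trivial p.2 trivial s trivial t trivial ((norm_fst_le p).trans hp_norm)
    ((norm_snd_le p).trans hp_norm) ((norm_fst_le (s, t)).trans h_norm)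
    ((norm_snd_le (s, t)).trans h_norm)

lemma memRectHolder (hf : RectHolderOn univ η η' f) (h_axes : VanishesOnAxesOn univ f)
    (hη : 0 < η) (hη' : 0 < η') {D : Set (ℝ × ℝ)} (hD : Bornology.IsBounded D) :
    MemRectHolder D η η' f := by
  refine ⟨(hf.continuous h_axes hη hη').continuousOn, ?_⟩
  obtain ⟨B, -, hB⟩ := hf (Metric.diam D)
  refine lt_of_le_of_lt ?_ (ENNReal.ofReal_lt_top (r := B))
  simp only [rectHolderNorm, iSup_le_iff]
  intro s₁ s₂ t₁ t₂ hs ht h_sub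
  refine ENNReal.ofReal_le_ofReal ?_
  have : 0 < |s₂ - s₁| := abs_pos.2 (sub_pos.2 hs).ne'
  have : 0 < |t₂ - t₁| := abs_pos.2 (sub_pos.2 ht).ne'
  rw [div_le_iff₀ (by positivity)]
  have h_diam := Metric.dist_le_diam_of_mem hD (h_sub (⟨⟨hs.le, le_rfl⟩, ⟨ht.le, le_rfl⟩⟩ :
    (s₂, t₂) ∈ Icc s₁ s₂ ×ˢ Icc t₁ t₂)) (h_sub (⟨⟨le_rfl, hs.le⟩, ⟨le_rfl, ht.le⟩⟩ :
    (s₁, t₁) ∈ Icc s₁ s₂ ×ˢ Icc t₁ t₂))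
  rw [Prod.dist_eq, max_le_iff, Real.dist_eq, Real.dist_eq] at h_diam
  exact hB s₁ trivial s₂ trivial t₁ trivial t₂ trivial h_diam.1 h_diam.2

section Dyadics

variable (hf : RectHolderOn dyadics η η' f) (h_axes : VanishesOnAxesOn dyadics f)
include hf h_axes

lemma tendsto_dyadicLim (hη : 0 < η) (hη' : 0 < η') (p : ℝ × ℝ) :
    Tendsto (fun n : ℕ => f (dyadicFloor n p.1, dyadicFloor n p.2)) atTop
      (𝓝 (FracNoise.dyadicLim f p)) := by
  obtain ⟨B, hB⟩ := hf.abs_sub_le h_axes hη hη' zero_mem_dyadics (‖p‖ + 1)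
  have h_abs : ∀ s n, |s| ≤ ‖p‖ → |dyadicFloor n s| ≤ ‖p‖ + 1 := fun s n hs => by
    linarith [abs_dyadicFloor_sub_le n s, abs_sub_abs_le_abs_sub (dyadicFloor n s) s]
  refine tendsto_nhds_limUnder (cauchySeq_tendsto_of_complete ?_)
  rw [cauchySeq_iff_tendsto_dist_atTop_0]
  have h_coord : ∀ s θ : ℝ, 0 < θ → Tendsto
      (fun n : ℕ × ℕ => |dyadicFloor n.1 s - dyadicFloor n.2 s| ^ θ) atTop (𝓝 0) := by
    intro s θ hθ
    rw [← prod_atTop_atTop_eq]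
    simpa [Real.zero_rpow hθ.ne'] using (((tendsto_dyadicFloor s).comp tendsto_fst).sub
      ((tendsto_dyadicFloor s).comp (tendsto_snd (f := (atTop : Filter ℕ))))).abs.rpow_const
        (p := θ) (Or.inr hθ.le)
  have h_bound := ((h_coord p.1 η hη).add (h_coord p.2 η' hη')).const_mul B
  rw [add_zero, mul_zero] at h_bound
  refine squeeze_zero (fun _ => dist_nonneg) (fun n => ?_) h_bound
  exact hB _ (dyadicFloor_mem _ _) _ (dyadicFloor_mem _ _) _ (dyadicFloor_mem _ _) _
    (dyadicFloor_mem _ _) (h_abs _ _ (norm_fst_le p)) (h_abs _ _ (norm_snd_le p))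
    (h_abs _ _ (norm_fst_le p)) (h_abs _ _ (norm_snd_le p))

lemma dyadicLim (hη : 0 < η) (hη' : 0 < η') : RectHolderOn univ η η' (dyadicLim f) := by
  intro L
  obtain ⟨B, hB₀, hB⟩ := hf (L + 2)
  refine ⟨B, hB₀, fun s₁ _ s₂ _ t₁ _ t₂ _ hs ht => ?_⟩
  have h_lim := fun s t => hf.tendsto_dyadicLim h_axes hη hη' (s, t)
  have h_incr : Tendsto (fun n => |rectIncr f (dyadicFloor n s₁) (dyadicFloor n s₂)
      (dyadicFloor n t₁) (dyadicFloor n t₂)|) atTop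
      (𝓝 |rectIncr (FracNoise.dyadicLim f) s₁ s₂ t₁ t₂|) :=
    ((((h_lim s₂ t₂).sub (h_lim s₂ t₁)).sub (h_lim s₁ t₂)).add (h_lim s₁ t₁)).abs
  have h_coord : ∀ a b θ : ℝ, 0 < θ → Tendsto
      (fun n : ℕ => |dyadicFloor n b - dyadicFloor n a| ^ θ) atTop (𝓝 (|b - a| ^ θ)) :=
    fun a b θ hθ =>
      ((tendsto_dyadicFloor b).sub (tendsto_dyadicFloor a)).abs.rpow_const (Or.inr hθ.le)
  have h_abs : ∀ a b n, |b - a| ≤ L → |dyadicFloor n b - dyadicFloor n a| ≤ L + 2 := by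
    intro a b n hab
    have ha := abs_le.1 (abs_dyadicFloor_sub_le n a)
    have hb := abs_le.1 (abs_dyadicFloor_sub_le n b)
    rw [abs_le] at hab ⊢
    constructor <;> linarith [ha.1, ha.2, hb.1, hb.2, hab.1, hab.2]
  exact le_of_tendsto_of_tendsto' h_incr
    (((h_coord _ _ η hη).mul (h_coord _ _ η' hη')).const_mul B)
    fun n => hB _ (dyadicFloor_mem _ _) _ (dyadicFloor_mem _ _) _ (dyadicFloor_mem _ _) _
      (dyadicFloor_mem _ _) (h_abs _ _ n hs) (h_abs _ _ n ht)

end Dyadics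

end RectHolderOn

/-! ### A two-parameter Kolmogorov estimate -/

/-- The dyadic intervals `[i/2ⁿ, (i+1)/2ⁿ]` contained in `[-N, N]`, as pairs `(n, i)`. -/
def dyadicCells (N : ℕ) : Set (ℕ × ℤ) := {I | -(N * 2 ^ I.1) ≤ I.2 ∧ I.2 < N * 2 ^ I.1}

/-- The length of the dyadic interval `I` to the power `a`, or zero if `I` is not contained in
`[-N, N]`. -/
def cellMass (N : ℕ) (a : ℝ) : ℕ × ℤ → ℝ≥0∞ :=
  (dyadicCells N).indicator fun I => ENNReal.ofReal (((1 / 2 : ℝ) ^ I.1) ^ a)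

/-- The sum over all dyadic cells of the `q`-th powers of the increments of `f`, normalized by the
rectangular Hölder bound. -/
def cellSum (q : ℕ) (η η' : ℝ) (f : ℝ × ℝ → ℝ) : ℝ≥0∞ :=
  ∑' c : (ℕ × ℤ) × (ℕ × ℤ),
    ‖cellIncr f c.1 c.2 / (((1 / 2 : ℝ) ^ c.1.1) ^ η * ((1 / 2 : ℝ) ^ c.2.1) ^ η')‖ₑ ^ q

lemma tsum_cellMass_level (N : ℕ) (a : ℝ) (n : ℕ) :
    ∑' i, cellMass N a (n, i) = ENNReal.ofReal (2 * N * ((1 / 2 : ℝ) ^ (a - 1)) ^ n) := by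
  have h_support : ∀ i, cellMass N a (n, i) =
      (Finset.Ico (-(N * 2 ^ n) : ℤ) (N * 2 ^ n) : Set ℤ).indicator
        (fun _ => ENNReal.ofReal (((1 / 2 : ℝ) ^ n) ^ a)) i := fun i => by
    simp only [cellMass, dyadicCells, indicator_apply, mem_ofPred_eq, Finset.coe_Ico, mem_Ico]
  have h_card : (Finset.Ico (-(N * 2 ^ n) : ℤ) (N * 2 ^ n)).card = 2 * N * 2 ^ n := by
    rw [Int.card_Ico, sub_neg_eq_add, ← two_mul, ← mul_assoc]
    exact_mod_cast Int.toNat_natCast (2 * N * 2 ^ n)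
  have h_rpow : (2 : ℝ) ^ n * ((1 / 2 : ℝ) ^ n) ^ a = ((1 / 2 : ℝ) ^ (a - 1)) ^ n := by
    rw [Real.rpow_pow_comm (by norm_num), Real.rpow_sub_one (by positivity), one_div_pow]
    field_simp
  rw [tsum_congr h_support, ← sum_eq_tsum_indicator, Finset.sum_const, h_card, nsmul_eq_mul,
    ← ENNReal.ofReal_natCast, ← ENNReal.ofReal_mul (by positivity), ← h_rpow]
  push_cast
  rw [mul_assoc]

lemma tsum_cellMass_lt_top (N : ℕ) {a : ℝ} (ha : 1 < a) : ∑' I, cellMass N a I < ⊤ := by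
  rw [ENNReal.tsum_prod']
  simp only [tsum_cellMass_level]
  exact ((summable_geometric_of_lt_one (by positivity)
    (half_rpow_lt_one (sub_pos.2 ha))).mul_left _).tsum_ofReal_lt_top

lemma enorm_inv_pow_mul_cellMass (N q : ℕ) (γ η : ℝ) (I : ℕ × ℤ) :
    ‖(((1 / 2 : ℝ) ^ I.1) ^ η)⁻¹‖ₑ ^ q * cellMass N (q * γ) I = cellMass N (q * (γ - η)) I := by
  by_cases hI : I ∈ dyadicCells N
  · have h_pos : 0 < (1 / 2 : ℝ) ^ I.1 := by positivity
    rw [cellMass, cellMass, indicator_of_mem hI, indicator_of_mem hI,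
      Real.enorm_of_nonneg (by positivity), ← ENNReal.ofReal_pow (by positivity),
      ← ENNReal.ofReal_mul (by positivity), ← Real.rpow_neg h_pos.le, ← Real.rpow_mul_natCast
      h_pos.le, ← Real.rpow_add h_pos]
    congr 2
    ring
  · rw [cellMass, cellMass, indicator_of_notMem hI, indicator_of_notMem hI, mul_zero]

lemma exists_dyadicCellBound_of_cellSum_lt_top {q : ℕ} (hq : q ≠ 0) {η η' : ℝ} {f : ℝ × ℝ → ℝ}
    (hf : cellSum q η η' f < ⊤) : ∃ K, DyadicCellBound η η' K f := by
  refine ⟨(cellSum q η η' f).toReal ^ (q : ℝ)⁻¹, fun I J => ?_⟩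
  have h_pos : 0 < ((1 / 2 : ℝ) ^ I.1) ^ η * ((1 / 2 : ℝ) ^ J.1) ^ η' := by positivity
  have h_term := ENNReal.toReal_mono hf.ne (ENNReal.le_tsum (f := fun c : (ℕ × ℤ) × (ℕ × ℤ) =>
    ‖cellIncr f c.1 c.2 / (((1 / 2 : ℝ) ^ c.1.1) ^ η * ((1 / 2 : ℝ) ^ c.2.1) ^ η')‖ₑ ^ q) (I, J))
  rw [ENNReal.toReal_pow, toReal_enorm, Real.norm_eq_abs, abs_div, abs_of_pos h_pos] at h_term
  rw [← div_le_iff₀ h_pos]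
  rw [Real.le_rpow_inv_iff_of_pos (by positivity) (by positivity) (by positivity),
    Real.rpow_natCast]
  exact h_term

section Kolmogorov

variable {Ω : Type*} [MeasurableSpace Ω] {P : Measure Ω} {Z : ℝ × ℝ → Ω → ℝ}
  {γ γ' η η' : ℝ} {q N : ℕ} {C : ℝ≥0∞}

lemma aemeasurable_cellIncr (hZ : ∀ p, AEMeasurable (Z p) P) (I J : ℕ × ℤ) :
    AEMeasurable (fun ω => cellIncr (fun p => Z p ω) I J) P :=
  (((hZ _).sub (hZ _)).sub (hZ _)).add (hZ _)

lemma lintegral_cellSum (hZ : ∀ p, AEMeasurable (Z p) P) :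
    ∫⁻ ω, cellSum q η η' (fun p => Z p ω) ∂P = ∑' c : (ℕ × ℤ) × (ℕ × ℤ),
      ‖(((1 / 2 : ℝ) ^ c.1.1) ^ η)⁻¹‖ₑ ^ q * ‖(((1 / 2 : ℝ) ^ c.2.1) ^ η')⁻¹‖ₑ ^ q *
        ∫⁻ ω, ‖cellIncr (fun p => Z p ω) c.1 c.2‖ₑ ^ q ∂P := by
  have h_meas : ∀ I J, AEMeasurable (fun ω => ‖cellIncr (fun p => Z p ω) I J‖ₑ ^ q) P :=
    fun I J => (aemeasurable_cellIncr hZ I J).enorm.pow_const q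
  have h_term : ∀ (I J : ℕ × ℤ) (ω : Ω),
      ‖cellIncr (fun p => Z p ω) I J / (((1 / 2 : ℝ) ^ I.1) ^ η * ((1 / 2 : ℝ) ^ J.1) ^ η')‖ₑ ^ q =
        ‖(((1 / 2 : ℝ) ^ I.1) ^ η)⁻¹‖ₑ ^ q * ‖(((1 / 2 : ℝ) ^ J.1) ^ η')⁻¹‖ₑ ^ q *
          ‖cellIncr (fun p => Z p ω) I J‖ₑ ^ q := fun I J ω => by
    rw [div_eq_inv_mul, mul_inv, enorm_mul, enorm_mul, mul_pow, mul_pow]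
  simp only [cellSum, h_term]
  rw [lintegral_tsum]
  · refine tsum_congr fun c => ?_
    exact lintegral_const_mul'' _ (h_meas c.1 c.2)
  · intro c
    exact (h_meas c.1 c.2).const_mul _

lemma ae_exists_dyadicCellBound (hZ : ∀ p, AEMeasurable (Z p) P) (hC : C < ⊤)
    (hη : 1 < q * (γ - η)) (hη' : 1 < q * (γ' - η'))
    (h_moment : ∀ I J, ∫⁻ ω, ‖cellIncr (fun p => Z p ω) I J‖ₑ ^ q ∂P ≤
      C * (cellMass N (q * γ) I * cellMass N (q * γ') J)) :
    ∀ᵐ ω ∂P, ∃ K, DyadicCellBound η η' K (fun p => Z p ω) := by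
  have hq : q ≠ 0 := by
    rintro rfl
    norm_num at hη
  have h_finite : ∫⁻ ω, cellSum q η η' (fun p => Z p ω) ∂P < ⊤ := by
    calc ∫⁻ ω, cellSum q η η' (fun p => Z p ω) ∂P
        ≤ ∑' c : (ℕ × ℤ) × (ℕ × ℤ), ‖(((1 / 2 : ℝ) ^ c.1.1) ^ η)⁻¹‖ₑ ^ q *
          ‖(((1 / 2 : ℝ) ^ c.2.1) ^ η')⁻¹‖ₑ ^ q *
            (C * (cellMass N (q * γ) c.1 * cellMass N (q * γ') c.2)) := by
          rw [lintegral_cellSum hZ]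
          gcongr
          exact h_moment _ _
      _ = ∑' c : (ℕ × ℤ) × (ℕ × ℤ),
          C * (cellMass N (q * (γ - η)) c.1 * cellMass N (q * (γ' - η')) c.2) := by
          refine tsum_congr fun c => ?_
          rw [← enorm_inv_pow_mul_cellMass, ← enorm_inv_pow_mul_cellMass N q γ' η']
          ring
      _ = C * ((∑' I, cellMass N (q * (γ - η)) I) * ∑' J, cellMass N (q * (γ' - η')) J) := by
          rw [ENNReal.tsum_mul_left, ENNReal.tsum_prod']
          simp only [ENNReal.tsum_mul_left, ENNReal.tsum_mul_right]
      _ < ⊤ := ENNReal.mul_lt_top hC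
          (ENNReal.mul_lt_top (tsum_cellMass_lt_top N hη) (tsum_cellMass_lt_top N hη'))
  have h_meas : AEMeasurable (fun ω => cellSum q η η' (fun p => Z p ω)) P :=
    AEMeasurable.tsum fun c => ((aemeasurable_cellIncr hZ c.1 c.2).div_const _).enorm.pow_const q
  filter_upwards [ae_lt_top' h_meas h_finite.ne] with ω hω
  exact exists_dyadicCellBound_of_cellSum_lt_top hq hω

end Kolmogorov

/-! ### The corner process -/

lemma hasCovMeasure_rotatedNoise {Ω : Type*} [MeasurableSpace Ω] {P : Measure Ω}
    {H ν T : ℝ} (R₁ R₂ : ℝ) (hH : H ∈ Ioo (1 / 2 : ℝ) 1) (hν : ν ∈ Ioo (0 : ℝ) 1)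
    {X : PlaneTest → Ω → ℝ} (hX : IsFractionalNoise P H ν T X) :
    HasCovMeasure P (rotatedNoise X) (domain R₁ R₂ T) (noiseMeasure H ν (domain R₁ R₂ T)) where
  gaussian φ := hX.gaussian.hasGaussianLaw_eval (compRot φ)
  centered φ := hX.centered (compRot φ)
  cov φ ψ hφ hψ := by
    rw [← noiseCov_compRot hH hν hφ hψ]
    exact hX.covariance (compRot φ) (compRot ψ)
  finite := isFiniteMeasure_noiseMeasure hH hν (isCompact_domain R₁ R₂ T).measurableSet
    (isCompact_domain R₁ R₂ T).isBounded
  ac := noiseMeasure_absolutelyContinuous H ν _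

lemma exists_isApproximating_cornerRect {D : Set (ℝ × ℝ)} (hD : IsCompact D)
    (hconv : Convex ℝ D) (p : ℝ × ℝ) : ∃ φ, IsApproximating D (cornerRect D p) φ :=
  exists_isApproximating ((isCompact_uIcc.prod isCompact_uIcc).inter hD)
    (((convex_uIcc _ _).prod (convex_uIcc _ _)).inter hconv) inter_subset_right

lemma ae_fst_ne (c : ℝ) : ∀ᵐ x ∂(volume : Measure (ℝ × ℝ)), x.1 ≠ c :=
  (Measure.quasiMeasurePreserving_fst (μ := (volume : Measure ℝ))
    (ν := (volume : Measure ℝ))).ae (Measure.ae_ne volume c)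

lemma ae_snd_ne (c : ℝ) : ∀ᵐ x ∂(volume : Measure (ℝ × ℝ)), x.2 ≠ c :=
  (Measure.quasiMeasurePreserving_snd (μ := (volume : Measure ℝ))
    (ν := (volume : Measure ℝ))).ae (Measure.ae_ne volume c)

lemma abs_indicator_uIcc_sub_le {a b : ℝ} (hab : a ≤ b) (x : ℝ) :
    |(uIcc 0 b).indicator 1 x - (uIcc 0 a).indicator (1 : ℝ → ℝ) x| ≤ (Icc a b).indicator 1 x := by
  by_cases hx : x ∈ Icc a b
  · rw [indicator_of_mem hx]
    by_cases ha : x ∈ uIcc 0 a <;> by_cases hb : x ∈ uIcc 0 b <;> simp [ha, hb]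
  · have h_iff : x ∈ uIcc 0 b ↔ x ∈ uIcc 0 a := by
      simp only [mem_uIcc, mem_Icc] at hx ⊢
      grind
    have h_eq : (uIcc 0 b).indicator (1 : ℝ → ℝ) x = (uIcc 0 a).indicator 1 x :=
      indicator_const_eq_indicator_const h_iff
    rw [indicator_of_notMem hx, h_eq, sub_self, abs_zero]

lemma tendsto_indicator_uIcc {ι : Type*} {l : Filter ι} {a : ι → ℝ} {s x : ℝ}
    (ha : Tendsto a l (𝓝 s)) (hx : x ≠ s) :
    Tendsto (fun i => (uIcc 0 (a i)).indicator (1 : ℝ → ℝ) x) l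
      (𝓝 ((uIcc 0 s).indicator 1 x)) := by
  have h_iff : ∀ᶠ i in l, (x ∈ uIcc 0 s ↔ x ∈ uIcc 0 (a i)) := by
    rcases hx.lt_or_gt with hx | hx
    · filter_upwards [ha.eventually_const_lt hx] with i hi
      simp only [mem_uIcc]
      grind
    · filter_upwards [ha.eventually_lt_const hx] with i hi
      simp only [mem_uIcc]
      grind
  refine tendsto_const_nhds.congr' ?_
  filter_upwards [h_iff] with i hi
  exact indicator_const_eq_indicator_const hi

lemma indicator_prod_inter_one (A B : Set ℝ) (D : Set (ℝ × ℝ)) (x : ℝ × ℝ) :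
    ((A ×ˢ B) ∩ D).indicator (1 : ℝ × ℝ → ℝ) x =
      A.indicator 1 x.1 * B.indicator 1 x.2 * D.indicator 1 x := by
  rw [inter_indicator_one, Pi.mul_apply, indicator_prod_one]

lemma indicator_cornerRect (D : Set (ℝ × ℝ)) (p x : ℝ × ℝ) :
    (cornerRect D p).indicator (fun _ => (1 : ℝ)) x =
      (uIcc 0 p.1).indicator 1 x.1 * (uIcc 0 p.2).indicator 1 x.2 * D.indicator 1 x :=
  indicator_prod_inter_one _ _ D x

lemma abs_rectIncr_indicator_cornerRect_le (D : Set (ℝ × ℝ)) {s₁ s₂ t₁ t₂ : ℝ} (hs : s₁ ≤ s₂)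
    (ht : t₁ ≤ t₂) (x : ℝ × ℝ) :
    |rectIncr (fun p => (cornerRect D p).indicator (fun _ => 1) x) s₁ s₂ t₁ t₂| ≤
      ((Icc s₁ s₂ ×ˢ Icc t₁ t₂) ∩ D).indicator 1 x := by
  have h_nonneg : 0 ≤ D.indicator (1 : ℝ × ℝ → ℝ) x := indicator_nonneg (fun _ _ => zero_le_one) x
  have h_product : rectIncr (fun p => (cornerRect D p).indicator (fun _ => 1) x) s₁ s₂ t₁ t₂ =
      ((uIcc 0 s₂).indicator 1 x.1 - (uIcc 0 s₁).indicator 1 x.1) *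
        ((uIcc 0 t₂).indicator 1 x.2 - (uIcc 0 t₁).indicator 1 x.2) * D.indicator 1 x := by
    simp only [rectIncr, indicator_cornerRect]
    ring
  rw [h_product, indicator_prod_inter_one, abs_mul, abs_mul, abs_of_nonneg h_nonneg]
  gcongr
  · exact indicator_nonneg (fun _ _ => zero_le_one) _
  · exact abs_indicator_uIcc_sub_le hs _
  · exact abs_indicator_uIcc_sub_le ht _

lemma cell_inter_eq_empty {D : Set (ℝ × ℝ)} {N : ℕ} (hN : ∀ x ∈ D, ‖x‖ < N) {I J : ℕ × ℤ}
    (hIJ : I ∉ dyadicCells N ∨ J ∉ dyadicCells N) :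
    (Icc ((I.2 : ℝ) / 2 ^ I.1) (((I.2 : ℝ) + 1) / 2 ^ I.1) ×ˢ
      Icc ((J.2 : ℝ) / 2 ^ J.1) (((J.2 : ℝ) + 1) / 2 ^ J.1)) ∩ D = ∅ := by
  have h_far : ∀ {I : ℕ × ℤ} {y : ℝ}, y ∈ Icc ((I.2 : ℝ) / 2 ^ I.1) (((I.2 : ℝ) + 1) / 2 ^ I.1) →
      |y| < N → I ∈ dyadicCells N := by
    rintro I y ⟨h_left, h_right⟩ hy
    rw [abs_lt] at hy
    rw [div_le_iff₀ (by positivity)] at h_left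
    rw [le_div_iff₀ (by positivity)] at h_right
    have h_pow : (0 : ℝ) < 2 ^ I.1 := by positivity
    have h_lower : -((N : ℝ) * 2 ^ I.1) < I.2 + 1 := by nlinarith
    have h_upper : (I.2 : ℝ) < N * 2 ^ I.1 := by nlinarith
    exact ⟨Int.lt_add_one_iff.1 (by exact_mod_cast h_lower), by exact_mod_cast h_upper⟩
  rw [eq_empty_iff_forall_notMem]
  rintro x ⟨⟨hx_fst, hx_snd⟩, hxD⟩
  exact hIJ.elim (· (h_far hx_fst ((norm_fst_le x).trans_lt (hN x hxD))))
    (· (h_far hx_snd ((norm_snd_le x).trans_lt (hN x hxD))))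

namespace HasCovMeasure

variable {Ω : Type*} [MeasurableSpace Ω] {P : Measure Ω} {Y : PlaneTest → Ω → ℝ}
  {D : Set (ℝ × ℝ)} {m : Measure ((ℝ × ℝ) × (ℝ × ℝ))} {Z : ℝ × ℝ → Ω → ℝ} {γ γ' η η' : ℝ}
  (hY : HasCovMeasure P Y D m)
  (hZ : ∀ p, IsWienerIntegral P Y D ((cornerRect D p).indicator fun _ => 1) (Z p))
include hY hZ

lemma lintegral_rectIncr_pow_le {s₁ s₂ t₁ t₂ : ℝ} (hs : s₁ ≤ s₂) (ht : t₁ ≤ t₂) (k : ℕ) :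
    ∫⁻ ω, ‖rectIncr (fun p => Z p ω) s₁ s₂ t₁ t₂‖ₑ ^ (2 * k) ∂P ≤ gaussMoment k *
      m (((Icc s₁ s₂ ×ˢ Icc t₁ t₂) ∩ D) ×ˢ ((Icc s₁ s₂ ×ˢ Icc t₁ t₂) ∩ D)) ^ k :=
  hY.lintegral_enorm_pow_le_measure (hY.isWienerIntegral_rectIncr hZ s₁ s₂ t₁ t₂)
    (abs_rectIncr_indicator_cornerRect_le D hs ht) k

lemma lintegral_cellIncr_pow_le {C : ℝ} (hC : 0 ≤ C) (hm : ∀ c d e f : ℝ, c ≤ d → e ≤ f →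
      m ((Icc c d ×ˢ Icc e f) ×ˢ (Icc c d ×ˢ Icc e f)) ≤
        ENNReal.ofReal (C * ((d - c) ^ (2 * γ) * (f - e) ^ (2 * γ'))))
    {N k : ℕ} (hN : ∀ x ∈ D, ‖x‖ < N) (hk : k ≠ 0) (I J : ℕ × ℤ) :
    ∫⁻ ω, ‖cellIncr (fun p => Z p ω) I J‖ₑ ^ (2 * k) ∂P ≤ gaussMoment k * ENNReal.ofReal C ^ k *
      (cellMass N ((2 * k : ℕ) * γ) I * cellMass N ((2 * k : ℕ) * γ') J) := by
  have h_le : ∀ I : ℕ × ℤ, (I.2 : ℝ) / 2 ^ I.1 ≤ ((I.2 : ℝ) + 1) / 2 ^ I.1 := fun I => by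
    gcongr
    exact (lt_add_one _).le
  refine (hY.lintegral_rectIncr_pow_le hZ (h_le I) (h_le J) k).trans ?_
  by_cases hIJ : I ∈ dyadicCells N ∧ J ∈ dyadicCells N
  · have h_length : ∀ I : ℕ × ℤ,
        ((I.2 : ℝ) + 1) / 2 ^ I.1 - I.2 / 2 ^ I.1 = (1 / 2 : ℝ) ^ I.1 := fun I => by
      rw [← sub_div, add_sub_cancel_left, one_div_pow]
    have h_rpow : ∀ (a : ℝ) (n : ℕ),
        (((1 / 2 : ℝ) ^ n) ^ (2 * a)) ^ k = ((1 / 2 : ℝ) ^ n) ^ ((2 * k : ℕ) * a) := fun a n => by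
      rw [← Real.rpow_mul_natCast (by positivity)]
      congr 1
      push_cast
      ring
    rw [cellMass, cellMass, indicator_of_mem hIJ.1, indicator_of_mem hIJ.2, mul_assoc,
      ← ENNReal.ofReal_mul (by positivity), ← h_rpow, ← h_rpow, ← mul_pow,
      ENNReal.ofReal_pow (by positivity), ← mul_pow, ← ENNReal.ofReal_mul hC, ← h_length I,
      ← h_length J]
    gcongr
    exact (measure_mono (prod_mono inter_subset_left inter_subset_left)).trans
      (hm _ _ _ _ (h_le I) (h_le J))
  · rw [cell_inter_eq_empty hN (not_and_or.1 hIJ), empty_prod, measure_empty, zero_pow hk, mul_zero]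
    exact zero_le

lemma ae_exists_dyadicCellBound (hD : Bornology.IsBounded D) (hm : HasRectBound m γ γ')
    (hη : η < γ) (hη' : η' < γ') : ∀ᵐ ω ∂P, ∃ K, DyadicCellBound η η' K (fun p => Z p ω) := by
  obtain ⟨C, hC, hm⟩ := hm
  obtain ⟨M, hM⟩ := hD.exists_norm_le
  obtain ⟨N, hN⟩ := exists_nat_gt M
  obtain ⟨k, hk⟩ := exists_nat_ge (max (1 / (γ - η)) (1 / (γ' - η')))
  have hkη : 1 ≤ k * (γ - η) := (div_le_iff₀ (sub_pos.2 hη)).1 ((le_max_left _ _).trans hk)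
  have hkη' : 1 ≤ k * (γ' - η') := (div_le_iff₀ (sub_pos.2 hη')).1 ((le_max_right _ _).trans hk)
  have hk₀ : k ≠ 0 := by
    rintro rfl
    norm_num at hkη
  refine FracNoise.ae_exists_dyadicCellBound (fun p => (hZ p).memLp.1.aemeasurable)
    (ENNReal.mul_lt_top (gaussMoment_lt_top k) (ENNReal.pow_lt_top ENNReal.ofReal_lt_top)) ?_ ?_
    (hY.lintegral_cellIncr_pow_le hZ hC hm (fun x hx => (hM x hx).trans_lt hN) hk₀)
  all_goals
    push_cast
    linarith

-- Reducing to countably many exponents makes the exceptional null set independent of them.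
lemma ae_rectHolderOn (hD : Bornology.IsBounded D) : ∀ᵐ ω ∂P, ∀ γ γ', HasRectBound m γ γ' →
    ∀ η ∈ Ioo 0 γ, ∀ η' ∈ Ioo 0 γ', RectHolderOn dyadics η η' (fun p => Z p ω) := by
  have h_rat : ∀ᵐ ω ∂P, ∀ a b : ℚ, (∃ γ γ', HasRectBound m γ γ' ∧ a < γ ∧ b < γ') →
      ∃ K, DyadicCellBound a b K (fun p => Z p ω) := by
    simp only [ae_all_iff]
    rintro a b ⟨γ, γ', hm, ha, hb⟩
    exact hY.ae_exists_dyadicCellBound hZ hD hm ha hb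
  filter_upwards [h_rat] with ω hω γ γ' hm η hη η' hη'
  obtain ⟨a, hηa, haγ⟩ := exists_rat_btwn hη.2
  obtain ⟨b, hηb, hbγ⟩ := exists_rat_btwn hη'.2
  obtain ⟨K, hK⟩ := hω a b ⟨γ, γ', hm, haγ, hbγ⟩
  exact (hK.mono hηa.le hηb.le).rectHolderOn hη.1 hη'.1

lemma ae_vanishesOnAxesOn_dyadics : ∀ᵐ ω ∂P, VanishesOnAxesOn dyadics (fun p => Z p ω) := by
  have h_null : ∀ p : ℝ × ℝ, p.1 = 0 ∨ p.2 = 0 → Z p =ᵐ[P] 0 := fun p hp => by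
    refine hY.ae_eq_zero_of_isWienerIntegral (g := fun _ => 0) ((hZ p).congr ?_) (by simp)
    filter_upwards [ae_fst_ne 0, ae_snd_ne 0] with x hx_fst hx_snd
    rw [indicator_cornerRect]
    rcases hp with hp | hp <;> simp [hp, hx_fst, hx_snd]
  filter_upwards [(ae_ball_iff countable_dyadics).2 fun t _ => h_null (0, t) (.inl rfl),
    (ae_ball_iff countable_dyadics).2 fun s _ => h_null (s, 0) (.inr rfl)] with ω h_left h_right
  exact ⟨h_left, h_right⟩

lemma tendstoInMeasure_dyadicFloor (hD : MeasurableSet D) (p : ℝ × ℝ) :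
    TendstoInMeasure P (fun n => Z (dyadicFloor n p.1, dyadicFloor n p.2)) atTop (Z p) := by
  have h_meas : ∀ p, Measurable ((cornerRect D p).indicator fun _ => (1 : ℝ)) := fun p =>
    measurable_const.indicator ((measurableSet_uIcc.prod measurableSet_uIcc).inter hD)
  have h_abs : ∀ p x, |(cornerRect D p).indicator (fun _ => (1 : ℝ)) x| ≤ 1 := fun p x => by
    by_cases hx : x ∈ cornerRect D p <;> simp [hx]
  refine hY.tendstoInMeasure_of_isWienerIntegral (fun n => hZ _) (hZ p) (fun n => h_meas _)
    (h_meas p) (fun n x => (abs_sub _ _).trans (add_le_add (h_abs _ x) (h_abs p x))) ?_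
  filter_upwards [ae_fst_ne p.1, ae_snd_ne p.2] with x hx_fst hx_snd
  simp only [indicator_cornerRect]
  exact ((tendsto_indicator_uIcc (tendsto_dyadicFloor _) hx_fst).mul
    (tendsto_indicator_uIcc (tendsto_dyadicFloor _) hx_snd)).mul_const _

lemma ae_dyadicLim_eq (hD : IsCompact D) (hm : HasRectBound m γ γ') (hγ : 0 < γ) (hγ' : 0 < γ')
    (p : ℝ × ℝ) : (fun ω => dyadicLim (fun q => Z q ω) p) =ᵐ[P] Z p := by
  obtain ⟨ns, hns, h_subseq⟩ :=
    (hY.tendstoInMeasure_dyadicFloor hZ hD.measurableSet p).exists_seq_tendsto_ae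
  filter_upwards [hY.ae_rectHolderOn hZ hD.isBounded, hY.ae_vanishesOnAxesOn_dyadics hZ, h_subseq]
    with ω h_holder h_axes hω
  have h_lim := (h_holder γ γ' hm _ ⟨half_pos hγ, half_lt_self hγ⟩ _
    ⟨half_pos hγ', half_lt_self hγ'⟩).tendsto_dyadicLim h_axes (half_pos hγ) (half_pos hγ') p
  exact tendsto_nhds_unique (h_lim.comp hns.tendsto_atTop) hω

lemma ae_memRectHolder_dyadicLim (hD : Bornology.IsBounded D) :
    ∀ᵐ ω ∂P, ∀ γ γ', HasRectBound m γ γ' → ∀ η ∈ Ioo 0 γ, ∀ η' ∈ Ioo 0 γ',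
      MemRectHolder D η η' (dyadicLim fun p => Z p ω) := by
  filter_upwards [hY.ae_rectHolderOn hZ hD, hY.ae_vanishesOnAxesOn_dyadics hZ]
    with ω h_holder h_axes γ γ' hm η hη η' hη'
  exact ((h_holder γ γ' hm η hη η' hη').dyadicLim h_axes hη.1 hη'.1).memRectHolder
    h_axes.dyadicLim hη.1 hη'.1 hD

end HasCovMeasure

end FracNoise

end

open FracNoise in
theorem lemma3p4 {Ω : Type*} [MeasurableSpace Ω] (P : Measure Ω) [IsProbabilityMeasure P]
    (H ν T R₁ R₂ : ℝ) (hH : H ∈ Ioo (1 / 2 : ℝ) 1) (hν : ν ∈ Ioo (0 : ℝ) 1) (hT : 0 < T)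
    (hR : R₁ < R₂) (X : FracNoise.PlaneTest → Ω → ℝ)
    (hX : FracNoise.IsFractionalNoise P H ν T X) :
    -- the process `x` is well defined, up to almost sure equality at each point of the domain
    (∀ p ∈ FracNoise.domain R₁ R₂ T, ∃ ξ : Ω → ℝ,
      FracNoise.IsRotatedNoiseOfSet P X (FracNoise.domain R₁ R₂ T)
        (FracNoise.cornerRect (FracNoise.domain R₁ R₂ T) p) ξ) ∧
    -- and it has a modification `y` whose paths have the asserted regularity
    ∀ x : ℝ × ℝ → Ω → ℝ,
      (∀ p ∈ FracNoise.domain R₁ R₂ T,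
        FracNoise.IsRotatedNoiseOfSet P X (FracNoise.domain R₁ R₂ T)
          (FracNoise.cornerRect (FracNoise.domain R₁ R₂ T) p) (x p)) →
      ∃ y : ℝ × ℝ → Ω → ℝ,
        (∀ p ∈ FracNoise.domain R₁ R₂ T, y p =ᵐ[P] x p) ∧
        ∀ᵐ ω ∂P, ∀ γ γ' : ℝ, γ ∈ Ioo (1 / 2 : ℝ) 1 → γ' ∈ Ioo (1 / 2 : ℝ) 1 →
          γ + γ' = H + (2 - ν) / 2 →
          ∀ η ∈ Ioo 0 γ, ∀ η' ∈ Ioo 0 γ',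
            FracNoise.MemRectHolder (FracNoise.domain R₁ R₂ T) η η' (fun p => y p ω) := by
  have hY := hasCovMeasure_rotatedNoise R₁ R₂ hH hν hX
  have hD := isCompact_domain R₁ R₂ T
  have h_exists : ∀ p, ∃ ξ, IsRotatedNoiseOfSet P X (domain R₁ R₂ T)
      (cornerRect (domain R₁ R₂ T) p) ξ := fun p =>
    hY.exists_isRotatedNoiseOfSet
      (exists_isApproximating_cornerRect hD (convex_domain R₁ R₂ T) p)
  refine ⟨fun p _ => h_exists p, fun x hx => ?_⟩
  choose Z hZ using h_exists
  have hZ_wiener := fun p => (hZ p).isWienerIntegral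
  refine ⟨fun p ω => dyadicLim (fun q => Z q ω) p, fun p hp => ?_, ?_⟩
  · have h_mid : (H + (2 - ν) / 2) / 2 ∈ Ioo (1 / 2 : ℝ) 1 :=
      ⟨by linarith [hH.1, hν.2], by linarith [hH.2, hν.1]⟩
    have h_pos : 0 < (H + (2 - ν) / 2) / 2 := one_half_pos.trans h_mid.1
    exact (hY.ae_dyadicLim_eq hZ_wiener hD
      (hasRectBound_noiseMeasure hH hν h_mid h_mid (add_halves _) _) h_pos h_pos p).trans
      (hY.ae_eq_of_isWienerIntegral (hZ_wiener p) (hx p hp).isWienerIntegral)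
  · filter_upwards [hY.ae_memRectHolder_dyadicLim hZ_wiener hD.isBounded] with ω hω γ γ' hγ hγ' hsum
    exact hω γ γ' (hasRectBound_noiseMeasure hH hν hγ hγ' hsum _)
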